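/- **Theorem (type preservation for the encoding of System $F^{\epsilon+sn}$ into $\mathrm{Met}(\mathcal S)$).** *Source calculus (System $F^{\epsilon+sn}$: Koka with scope-safe named handlers).* Kinds $K ::= \mathsf{Value}\mid\mathsf{Effect}\mid\mathsf{Scope}(\ell)$; value types $A,B ::= 1\mid\alpha\mid A\to^E B\mid\forall\alpha^K.A\mid \mathsf{ev}\,\ell^a$; effect rows $E ::= \cdot\mid\varepsilon\mid \ell^a,E$, taken up to reordering of labels (and types accordingly: values and computations may be retyped along this equivalence); values $V,W ::= ()\mid x\mid\lambda^E x^A.M\mid\Lambda\alpha^K.V\mid \mathbf{nhandler}\,\{\ell\,p\,r\mapsto N\}$; computations $M,N ::= \mathbf{return}\,V\mid V\,W\mid V\,A\mid\mathbf{let}\,x=M\,\mathbf{in}\,N\mid\mathbf{do}\,V\,W$. In $\mathsf{ev}\,\ell^a$ and $\ell^a,E$ the variable $a$ has kind $\mathsf{Scope}(\ell)$ and $\ell$ is declared in $\Sigma$. A fixed global label context $\Sigma$ assigns to operation labels $\ell$ signatures $A\twoheadrightarrow B$ with $A,B$ closed value types, and signatures do not refer (directly or indirectly) to themselves through evidence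 types $\mathsf{ev}\,\ell^a$. Typing $\Gamma\vdash V:A$ and $\Gamma\vdash M:A\mid E$ is as usual for a fine-grain call-by-value System F with effect rows (contexts, annotations and ambient rows being well-kinded; $\mathbf{return}\,V$ and $V\,A$ are typed at any row), together with: if $\Sigma\ni\ell:A'\twoheadrightarrow B'$ and $\Gamma,p:A',r:B'\to^E A\vdash N:A\mid E$, then $\Gamma\vdash\mathbf{nhandler}\,\{\ell\,p\,r\mapsto N\}:(\forall a^{\mathsf{Scope}(\ell)}.\,\mathsf{ev}\,\ell^a\to^{\ell^a,E}A)\to^E A$; and if $\Sigma\ni\ell:A\twoheadrightarrow B$, $\Gamma\vdash V:\mathsf{ev}\,\ell^a$ and $\Gamma\vdash W:A$, then $\Gamma\vdash\mathbf{do}\,V\,W:B\mid\ell^a,E$. *Target calculus ($\mathrm{Met}(\mathcal S)$: modal effect types over the effect theory of sets).* Extensions $D$ and effect contexts $E,F$ are lists of (global or local) labels and effect variables, $E\equiv F$ means equality as sets, and $E\leqslant F$ iff $E,E'\equiv F$ for some $E'$ with $E,E'$ well-formed. Modalities are $\mu,\nu ::= [E]\mid\langle D\rangle$, acting by $[E](F)=E$,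 $\langle D\rangle(F)=D,F$ and composing by $\mu\circ[E]=[E]$, $[E]\circ\langle D\rangle=[D,E]$, $\langle D_1\rangle\circ\langle D_2\rangle=\langle D_2,D_1\rangle$. Transformations are: $[E]\Rightarrow\mu\ @\ F$ if $E\leqslant\mu(F)$; $\langle D_1\rangle\Rightarrow\langle D_2\rangle\ @\ E$ if $D_1,F\leqslant D_2,F$ for all $F\geqslant E$. Types are $1,\alpha,A\to B,\mu A,\forall\alpha^K.A$ with kinds $\mathsf{Abs}\le\mathsf{Any}$ (arrows have kind $\mathsf{Any}$, $[E]A$ has kind $\mathsf{Abs}$, $\langle D\rangle A$ and $\forall\alpha^K.A$ have the kind of $A$) and $\mathsf{Effect}$ for effect contexts; operation signatures have both types of kind $\mathsf{Abs}$. Contexts contain type variables, local labels $\ell:A\twoheadrightarrow B$, bindings $x:_{\mu_F}A$ and locks $\mu_F$. In $\Gamma\vdash M:A\ @\ E$ the context is well-formed at $E$ (written $\Gamma\ @\ E$: reading from left to right, a lock $\mu_F$ changes the effect context from $F$ to $\mu(F)$ and bindings are tagged with the current effect context). The rules, besides the usual ones for unit, functions, type abstraction (over a value), type application and retyping along type equivalence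 (equality of types with modalities compared up to $\equiv$), are: (Var) in $\Gamma,x:_{\mu_F}A,\Gamma'$, $x$ has type $A$ if $A$ has kind $\mathsf{Abs}$ or $\mu\Rightarrow\nu\ @\ F$, with $\nu$ the composition of the locks in $\Gamma'$; (Mod) $\Gamma\vdash\mathbf{mod}_\mu V:\mu A\ @\ F$ if $\Gamma,\text{lock}_{\mu_F}\vdash V:A\ @\ \mu(F)$, $V$ a value; (Letmod) $\Gamma\vdash\mathbf{let}_\nu\,\mathbf{mod}_\mu\,x=V\,\mathbf{in}\,M:B\ @\ F$ if $\Gamma,\text{lock}_{\nu_F}\vdash V:\mu A\ @\ \nu(F)$ and $\Gamma,x:_{(\nu\circ\mu)_F}A\vdash M:B\ @\ F$, $V$ a value (for $\nu=\langle\rangle$ the subscript is omitted); (Do) $\Gamma\vdash\mathbf{do}\,\ell\,N:B\ @\ \ell,E$ if $\ell:A\twoheadrightarrow B$ and $\Gamma\vdash N:A\ @\ \ell,E$; (Local) $\Gamma\vdash\mathbf{local}\,\ell:A\twoheadrightarrow B\,\mathbf{in}\,M:A'\ @\ E$ if $\Gamma,\ell:A\twoheadrightarrow B\vdash M:A'\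 @\ E$, where $A',E$ are well-formed in $\Gamma$; (Handle) $\Gamma\vdash\mathbf{handle}^\mu\,M\,\mathbf{with}\,\{\mathbf{return}\,x\mapsto N,\ \ell\,p\,r\mapsto N'\}:B\ @\ F$ if, with $E=\mu(F)$ and $\ell:A'\twoheadrightarrow B'$: $\mu\Rightarrow\langle\rangle\ @\ F$, $\mu\Rightarrow\mu\circ\mu\ @\ F$, $\Gamma,\text{lock}_{\mu_F},\text{lock}_{\langle\ell\rangle_E}\vdash M:A\ @\ \ell,E$, $\ \Gamma,\text{lock}_{\mu_F},x:(\mu\circ\langle\ell\rangle)A\vdash N:B\ @\ E$ and $\Gamma,\text{lock}_{\mu_F},p:A',r:\mu(B'\to B)\vdash N':B\ @\ E$. *Translation* (by recursion on source typing derivations; equivalence steps are not recorded). Kinds: $[\![\mathsf{Value}]\!]=\mathsf{Abs}$, $[\![\mathsf{Effect}]\!]=[\![\mathsf{Scope}(\ell)]\!]=\mathsf{Effect}$. Rows: $[\![\cdot]\!]=\cdot$, $[\![\varepsilon]\!]=\varepsilon$, $[\![\ell^a,E]\!]=a,[\![E]\!]$. Types: $[\![1]\!]=1$, $[\![\alpha]\!]=\alpha$,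 $[\![A\to^E B]\!]=[[\![E]\!]]([\![A]\!]\to[\![B]\!])$, $[\![\forall\alpha^K.A]\!]=\forall\alpha^{[\![K]\!]}.[\![A]\!]$, and $[\![\mathsf{ev}\,\ell^a]\!]=[a]([\![A]\!]\to[\![B]\!])$ if $\Sigma\ni\ell:A\twoheadrightarrow B$. Contexts and $\Sigma$ are translated entrywise. Terms: $[\![()]\!]=()$, $[\![x]\!]=x$, $[\![\lambda^E x^A.M]\!]=\mathbf{mod}_{[[\![E]\!]]}(\lambda x^{[\![A]\!]}.[\![M]\!])$, $[\![\Lambda\alpha^K.V]\!]=\Lambda\alpha^{[\![K]\!]}.[\![V]\!]$, $[\![\mathbf{return}\,V]\!]=[\![V]\!]$, $[\![V\,A]\!]=[\![V]\!]\,[\![A]\!]$ (with $[\![a]\!]=a$ for a scope variable), $[\![\mathbf{let}\,x=M\,\mathbf{in}\,N]\!]=(\lambda x^{[\![A]\!]}.[\![N]\!])\,[\![M]\!]$ for $M$ of type $A$, $[\![V\,W]\!]=\mathbf{let}\,\mathbf{mod}_{[[\![E]\!]]}\,x=[\![V]\!]\,\mathbf{in}\,x\,[\![W]\!]$ for $V:A\to^E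 B$, $[\![\mathbf{do}\,V\,W]\!]=\mathbf{let}\,\mathbf{mod}_{[a]}\,x=[\![V]\!]\,\mathbf{in}\,x\,[\![W]\!]$ for $V:\mathsf{ev}\,\ell^a$, and $\mathbf{nhandler}\,\{\ell\,p\,r\mapsto N\}$ of type $(\forall a^{\mathsf{Scope}(\ell)}.\mathsf{ev}\,\ell^a\to^{\ell^a,E}A)\to^E A$, with $\Sigma\ni\ell:A'\twoheadrightarrow B'$, becomes $$\begin{array}{l}\mathbf{mod}_{[[\![E]\!]]}\bigl(\lambda f.\ \mathbf{local}\ \ell_a:[\![A']\!]\twoheadrightarrow[\![B']\!]\ \mathbf{in}\\ \quad\mathbf{handle}^{[[\![E]\!]]}\ \bigl(\mathbf{let}\,\mathbf{mod}_{[\ell_a,[\![E]\!]]}\,f'=f\,\ell_a\,\mathbf{in}\,f'\,(\mathbf{mod}_{[\ell_a]}(\lambda x^{[\![A']\!]}.\mathbf{do}\,\ell_a\,x))\bigr)\\ \quad\mathbf{with}\ \{\mathbf{return}\,x\mapsto\mathbf{let}\,\mathbf{mod}_{[\ell_a,[\![E]\!]]}\,x'=x\,\mathbf{in}\,x',\ \ell_a\,p\,r\mapsto[\![N]\!]\}\bigr)\end{array}$$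 with $f$ annotated by $[\![\forall a^{\mathsf{Scope}(\ell)}.\mathsf{ev}\,\ell^a\to^{\ell^a,E}A]\!]$. *Claim.* Let $\Sigma$ and $\Gamma$ be well-formed. Then $[\![\Sigma]\!]$ is a well-formed label context of $\mathrm{Met}(\mathcal S)$, and, relative to it: 1. if $\Gamma\vdash M:A\mid E$ in System $F^{\epsilon+sn}$, then $[\![\Gamma]\!]\vdash[\![M]\!]:[\![A]\!]\ @\ [\![E]\!]$ in $\mathrm{Met}(\mathcal S)$, for the translation $[\![M]\!]$ given by any derivation of the source judgement; 2. if $\Gamma\vdash V:A$ in System $F^{\epsilon+sn}$, then $[\![\Gamma]\!]\vdash[\![V]\!]:[\![A]\!]\ @\ F$ in $\mathrm{Met}(\mathcal S)$ for every effect context $F$ well-formed under $[\![\Gamma]\!]$ (in particular for the empty one), for the translation $[\![V]\!]$ given by any derivation of the source judgement. -/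

import Mathlib

/-! Both calculi use de Bruijn indices. Type-level variables and term variables are indexed
separately, and a context is accordingly given by a list `Δ` of kinds of the type-level variables
and a list `Γ` for the term variables, all of whose types live in the full scope `Δ`. Index `0` is
the most recent binding. -/

/-- Global operation labels. -/
abbrev OpName := ℕ

/-- Lift a renaming under one binder. -/
def liftRen (ρ : ℕ → ℕ) : ℕ → ℕ
  | 0 => 0
  | n + 1 => ρ n + 1

/-! ## The source calculus: System F^{ε+sn} -/

namespace FSn

inductive Kind where
  | value
  | effect
  | scope (l : OpName)

/-- Value types, effect rows and scope variables. They form one syntactic category, since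
type-level variables range over all of them; kinding separates them.
`arr A E B` is `A →^E B`, `ev l a` is the evidence type of `l` at scope `a`, and
`ext l a E` is the row `l^a, E`. -/
inductive Ty where
  | var (i : ℕ)
  | unit
  | arr (A E B : Ty)
  | all (K : Kind) (A : Ty)
  | ev (l : OpName) (a : Ty)
  | empty
  | ext (l : OpName) (a E : Ty)

namespace Ty

def ren : Ty → (ℕ → ℕ) → Ty
  | var i, ρ => var (ρ i)
  | unit, _ => unit
  | arr A E B, ρ => arr (A.ren ρ) (E.ren ρ) (B.ren ρ)
  | all K A, ρ => all K (A.ren (liftRen ρ))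
  | ev l a, ρ => ev l (a.ren ρ)
  | empty, _ => empty
  | ext l a E, ρ => ext l (a.ren ρ) (E.ren ρ)

/-- Weakening by one type-level variable. -/
def shift (A : Ty) : Ty := A.ren Nat.succ

def liftSubst (σ : ℕ → Ty) : ℕ → Ty
  | 0 => var 0
  | n + 1 => (σ n).shift

def subst : Ty → (ℕ → Ty) → Ty
  | var i, σ => σ i
  | unit, _ => unit
  | arr A E B, σ => arr (A.subst σ) (E.subst σ) (B.subst σ)
  | all K A, σ => all K (A.subst (liftSubst σ))
  | ev l a, σ => ev l (a.subst σ)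
  | empty, _ => empty
  | ext l a E, σ => ext l (a.subst σ) (E.subst σ)

/-- `B.inst A` is `B[A/α]`, where `α` is the variable with index `0`. -/
def inst (B A : Ty) : Ty :=
  B.subst fun i => match i with
    | 0 => A
    | n + 1 => var n

/-- `A.MentionsEv l`: an evidence type of the operation `l` occurs in `A`. -/
def MentionsEv (l : OpName) : Ty → Prop
  | var _ => False
  | unit => False
  | arr A E B => A.MentionsEv l ∨ E.MentionsEv l ∨ B.MentionsEv l
  | all _ A => A.MentionsEv l
  | ev l' a => l' = l ∨ a.MentionsEv l
  | empty => False
  | ext _ a E => a.MentionsEv l ∨ E.MentionsEv l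

end Ty

/-- Global label contexts: `S l = some (A, B)` is the entry `l : A ↠ B`. -/
abbrev Sig := OpName → Option (Ty × Ty)

/-- The kinding judgement `Δ ⊢ A : K`. -/
inductive Kinded (S : Sig) : List Kind → Ty → Kind → Prop
  | var {Δ i K} : Δ[i]? = some K → Kinded S Δ (.var i) K
  | unit {Δ} : Kinded S Δ .unit .value
  | arr {Δ A E B} : Kinded S Δ A .value → Kinded S Δ E .effect → Kinded S Δ B .value →
      Kinded S Δ (.arr A E B) .value
  | all {Δ K A} : Kinded S (K :: Δ) A .value → Kinded S Δ (.all K A) .value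
  | ev {Δ l a} : (S l).isSome → Kinded S Δ a (.scope l) → Kinded S Δ (.ev l a) .value
  | empty {Δ} : Kinded S Δ .empty .effect
  | ext {Δ l a E} : (S l).isSome → Kinded S Δ a (.scope l) → Kinded S Δ E .effect →
      Kinded S Δ (.ext l a E) .effect

/-- The evidence type of `l'` occurs in the signature of `l`. -/
def Sig.Uses (S : Sig) (l' l : OpName) : Prop :=
  ∃ A B, S l = some (A, B) ∧ (A.MentionsEv l' ∨ B.MentionsEv l')

/-- Well-formed global label contexts: the types in it are closed value types, and signatures do
not refer to themselves through evidence types (otherwise the translation of evidence types, which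
unfolds signatures, would not be defined). -/
structure Sig.Wf (S : Sig) : Prop where
  kinded : ∀ l A B, S l = some (A, B) → Kinded S [] A .value ∧ Kinded S [] B .value
  acyclic : WellFounded S.Uses

/-- Well-formedness of the term variable context `Γ` under `Δ`. -/
def CtxWf (S : Sig) (Δ : List Kind) (Γ : List Ty) : Prop := ∀ A ∈ Γ, Kinded S Δ A .value

/-- Effect rows are identified up to reordering, and types accordingly. -/
inductive Equiv : Ty → Ty → Prop
  | refl {A} : Equiv A A
  | symm {A B} : Equiv A B → Equiv B A
  | trans {A B C} : Equiv A B → Equiv B C → Equiv A C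
  | arr {A A' E E' B B'} : Equiv A A' → Equiv E E' → Equiv B B' →
      Equiv (.arr A E B) (.arr A' E' B')
  | all {K A A'} : Equiv A A' → Equiv (.all K A) (.all K A')
  | ext {l a E E'} : Equiv E E' → Equiv (.ext l a E) (.ext l a E')
  | swap {l a l' a' E} : Equiv (.ext l a (.ext l' a' E)) (.ext l' a' (.ext l a E))

mutual

/-- Values. `lam E A M` is `λ^E x^A. M`; `nhandler l N` is `nhandler {l p r ↦ N}`, where in `N` the
continuation `r` has index `0` and the parameter `p` has index `1`. -/
inductive Val where
  | unit
  | var (i : ℕ)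
  | lam (E A : Ty) (M : Comp)
  | tlam (K : Kind) (V : Val)
  | nhandler (l : OpName) (N : Comp)

/-- Computations. `perform V W` is `do V W`. -/
inductive Comp where
  | ret (V : Val)
  | app (V W : Val)
  | tapp (V : Val) (A : Ty)
  | letin (M N : Comp)
  | perform (V W : Val)

end

/-- The type `(∀ a^{Scope(l)}. ev l a →^{l^a, E} A) →^E A` of a named handler. -/
def handlerTy (l : OpName) (E A : Ty) : Ty :=
  .arr (.all (.scope l) (.arr (.ev l (.var 0)) (.ext l (.var 0) E.shift) A.shift)) E A

mutual

/-- Derivations of `Γ ⊢ V : A`. They form a type, since the translation is defined on them. -/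
inductive ValTyping (S : Sig) : List Kind → List Ty → Val → Ty → Type
  | unit {Δ Γ} : ValTyping S Δ Γ .unit .unit
  | var {Δ Γ i A} : Γ[i]? = some A → ValTyping S Δ Γ (.var i) A
  | lam {Δ Γ E A B M} : Kinded S Δ A .value → Kinded S Δ E .effect →
      CompTyping S Δ (A :: Γ) M B E →
      ValTyping S Δ Γ (.lam E A M) (.arr A E B)
  | tlam {Δ Γ K V A} : ValTyping S (K :: Δ) (Γ.map Ty.shift) V A →
      ValTyping S Δ Γ (.tlam K V) (.all K A)
  | nhandler {Δ Γ l A' B' A E N} : S l = some (A', B') →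
      Kinded S Δ A .value → Kinded S Δ E .effect →
      CompTyping S Δ (.arr B' E A :: A' :: Γ) N A E →
      ValTyping S Δ Γ (.nhandler l N) (handlerTy l E A)
  | conv {Δ Γ V A A'} : ValTyping S Δ Γ V A → Equiv A A' → ValTyping S Δ Γ V A'

/-- Derivations of `Γ ⊢ M : A | E`. -/
inductive CompTyping (S : Sig) : List Kind → List Ty → Comp → Ty → Ty → Type
  | ret {Δ Γ V A E} : ValTyping S Δ Γ V A → Kinded S Δ E .effect →
      CompTyping S Δ Γ (.ret V) A E
  | app {Δ Γ V W A B E} : ValTyping S Δ Γ V (.arr A E B) → ValTyping S Δ Γ W A →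
      CompTyping S Δ Γ (.app V W) B E
  | tapp {Δ Γ V K B A E} : ValTyping S Δ Γ V (.all K B) → Kinded S Δ A K →
      Kinded S Δ E .effect →
      CompTyping S Δ Γ (.tapp V A) (B.inst A) E
  | letin {Δ Γ M N A B E} : CompTyping S Δ Γ M A E → CompTyping S Δ (A :: Γ) N B E →
      CompTyping S Δ Γ (.letin M N) B E
  | perform {Δ Γ l a V W A B E} : S l = some (A, B) →
      ValTyping S Δ Γ V (.ev l a) → ValTyping S Δ Γ W A → Kinded S Δ E .effect →
      CompTyping S Δ Γ (.perform V W) B (.ext l a E)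
  | conv {Δ Γ M A A' E E'} : CompTyping S Δ Γ M A E → Equiv A A' → Equiv E E' →
      CompTyping S Δ Γ M A' E'

end

end FSn

/-! ## The target calculus: Met(𝒮), modal effect types over the effect theory of sets -/

namespace Met

inductive Kind where
  | abs
  | any
  | effect

/-- Labels are global, or local and bound by a local label binder (with de Bruijn indices of
their own). -/
inductive Label where
  | glob (l : OpName)
  | loc (i : ℕ)

inductive Atom where
  | lab (l : Label)
  | var (i : ℕ)

/-- Extensions and effect contexts: lists of labels and effect variables. -/
abbrev Eff := List Atom

/-- `abs E` is the absolute modality `[E]`, `ext D` is the extension modality `⟨D⟩`. -/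
inductive Modality where
  | abs (E : Eff)
  | ext (D : Eff)

/-- Value types; `box μ A` is `μ A`. -/
inductive Ty where
  | var (i : ℕ)
  | unit
  | arr (A B : Ty)
  | box (μ : Modality) (A : Ty)
  | all (K : Kind) (A : Ty)

/-- Arguments of type applications: value types or effect contexts. -/
inductive TArg where
  | ty (A : Ty)
  | eff (E : Eff)

/-! Renaming: `ρ` acts on type-level variables and `ξ` on local labels. -/

def Label.ren (ξ : ℕ → ℕ) : Label → Label
  | .glob l => .glob l
  | .loc i => .loc (ξ i)

def Atom.ren (ρ ξ : ℕ → ℕ) : Atom → Atom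
  | .lab l => .lab (l.ren ξ)
  | .var i => .var (ρ i)

def Eff.ren (ρ ξ : ℕ → ℕ) (E : Eff) : Eff := E.map (Atom.ren ρ ξ)

def Modality.ren (ρ ξ : ℕ → ℕ) : Modality → Modality
  | .abs E => .abs (Eff.ren ρ ξ E)
  | .ext D => .ext (Eff.ren ρ ξ D)

def Ty.ren : Ty → (ℕ → ℕ) → (ℕ → ℕ) → Ty
  | .var i, ρ, _ => .var (ρ i)
  | .unit, _, _ => .unit
  | .arr A B, ρ, ξ => .arr (A.ren ρ ξ) (B.ren ρ ξ)
  | .box μ A, ρ, ξ => .box (μ.ren ρ ξ) (A.ren ρ ξ)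
  | .all K A, ρ, ξ => .all K (A.ren (liftRen ρ) ξ)

def TArg.ren (ρ ξ : ℕ → ℕ) : TArg → TArg
  | .ty A => .ty (A.ren ρ ξ)
  | .eff E => .eff (Eff.ren ρ ξ E)

/-! Substitution for type-level variables: a variable is replaced by `σ.ty i` where it stands for
a value type, and by `σ.eff i` where it stands for an effect context. -/

structure Subst where
  ty : ℕ → Ty
  eff : ℕ → Eff

def Subst.lift (σ : Subst) : Subst where
  ty := fun i => match i with
    | 0 => .var 0
    | n + 1 => (σ.ty n).ren Nat.succ id
  eff := fun i => match i with
    | 0 => [.var 0]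
    | n + 1 => Eff.ren Nat.succ id (σ.eff n)

def Atom.subst (σ : Subst) : Atom → Eff
  | .lab l => [.lab l]
  | .var i => σ.eff i

def Eff.subst (σ : Subst) (E : Eff) : Eff := E.flatMap (Atom.subst σ)

def Modality.subst (σ : Subst) : Modality → Modality
  | .abs E => .abs (Eff.subst σ E)
  | .ext D => .ext (Eff.subst σ D)

def Ty.subst : Ty → Subst → Ty
  | .var i, σ => σ.ty i
  | .unit, _ => .unit
  | .arr A B, σ => .arr (A.subst σ) (B.subst σ)
  | .box μ A, σ => .box (μ.subst σ) (A.subst σ)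
  | .all K A, σ => .all K (A.subst σ.lift)

/-- The value type given by an argument (never used on effect contexts in well-kinded types). -/
def TArg.toTy : TArg → Ty
  | .ty A => A
  | .eff _ => .unit

/-- The effect context given by an argument (never used on value types in well-kinded types). -/
def TArg.toEff : TArg → Eff
  | .ty _ => []
  | .eff E => E

/-- `B.inst X` is `B[X/α]`, where `α` is the variable with index `0`. -/
def Ty.inst (B : Ty) (X : TArg) : Ty :=
  B.subst
    { ty := fun i => match i with
        | 0 => X.toTy
        | n + 1 => .var n
      eff := fun i => match i with
        | 0 => X.toEff
        | n + 1 => [.var n] }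

/-- Terms. `perform l M` is `do l M`; `letmod ν μ V M` is `let_ν mod_μ x = V in M`;
`localLabel A B M` binds a local label of type `A ↠ B` in `M`;
`handle μ l M N N'` is `handle^μ M with {return x ↦ N, l p r ↦ N'}`, where in `N'` the
continuation `r` has index `0` and the parameter `p` has index `1`. -/
inductive Term where
  | unit
  | var (i : ℕ)
  | lam (A : Ty) (M : Term)
  | app (M N : Term)
  | tlam (K : Kind) (V : Term)
  | tapp (M : Term) (X : TArg)
  | mod (μ : Modality) (V : Term)
  | letmod (ν μ : Modality) (V M : Term)
  | perform (l : Label) (M : Term)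
  | localLabel (A B : Ty) (M : Term)
  | handle (μ : Modality) (l : Label) (M N N' : Term)

/-- The terms that are (complex) values. -/
def Term.IsValue : Term → Prop
  | .unit => True
  | .var _ => True
  | .lam _ _ => True
  | .app _ _ => False
  | .tlam _ V => V.IsValue
  | .tapp V _ => V.IsValue
  | .mod _ V => V.IsValue
  | .letmod _ _ V W => V.IsValue ∧ W.IsValue
  | .perform _ _ => False
  | .localLabel _ _ _ => False
  | .handle _ _ _ _ _ => False

/-- Renaming in terms: `ρ` acts on term variables and `ξ` on local labels. -/
def Term.ren : Term → (ℕ → ℕ) → (ℕ → ℕ) → Term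
  | .unit, _, _ => .unit
  | .var i, ρ, _ => .var (ρ i)
  | .lam A M, ρ, ξ => .lam (A.ren id ξ) (M.ren (liftRen ρ) ξ)
  | .app M N, ρ, ξ => .app (M.ren ρ ξ) (N.ren ρ ξ)
  | .tlam K V, ρ, ξ => .tlam K (V.ren ρ ξ)
  | .tapp M X, ρ, ξ => .tapp (M.ren ρ ξ) (X.ren id ξ)
  | .mod μ V, ρ, ξ => .mod (μ.ren id ξ) (V.ren ρ ξ)
  | .letmod ν μ V M, ρ, ξ =>
      .letmod (ν.ren id ξ) (μ.ren id ξ) (V.ren ρ ξ) (M.ren (liftRen ρ) ξ)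
  | .perform l M, ρ, ξ => .perform (l.ren ξ) (M.ren ρ ξ)
  | .localLabel A B M, ρ, ξ =>
      .localLabel (A.ren id ξ) (B.ren id ξ) (M.ren ρ (liftRen ξ))
  | .handle μ l M N N', ρ, ξ =>
      .handle (μ.ren id ξ) (l.ren ξ) (M.ren ρ ξ) (N.ren (liftRen ρ) ξ)
        (N'.ren (liftRen (liftRen ρ)) ξ)

/-! ### Modalities and contexts -/

/-- The action of a modality on effect contexts. -/
def Modality.act : Modality → Eff → Eff
  | .abs E, _ => E
  | .ext D, F => D ++ F

/-- The identity modality `⟨⟩`. -/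
def Modality.one : Modality := .ext []

/-- Composition of modalities, from left to right. -/
def Modality.comp : Modality → Modality → Modality
  | _, .abs E => .abs E
  | .abs E, .ext D => .abs (D ++ E)
  | .ext D₁, .ext D₂ => .ext (D₂ ++ D₁)

/-- `var μ F A` is a binding `x :_{μ_F} A`, and `lock μ F` is the lock of `μ_F`. -/
inductive Entry where
  | var (μ : Modality) (F : Eff) (A : Ty)
  | lock (μ : Modality) (F : Eff)

def Entry.ren (ρ ξ : ℕ → ℕ) : Entry → Entry
  | .var μ F A => .var (μ.ren ρ ξ) (Eff.ren ρ ξ F) (A.ren ρ ξ)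
  | .lock μ F => .lock (μ.ren ρ ξ) (Eff.ren ρ ξ F)

/-- Ordered lists of term variables and locks, the most recent entry first. -/
abbrev Ctx := List Entry

/-- Contexts of local labels; an entry `(A, B)` is `l : A ↠ B`. -/
abbrev LCtx := List (Ty × Ty)

def Ctx.ren (ρ ξ : ℕ → ℕ) (Γ : Ctx) : Ctx := Γ.map (Entry.ren ρ ξ)

def LCtx.ren (ρ ξ : ℕ → ℕ) (Λ : LCtx) : LCtx := Λ.map fun s => (s.1.ren ρ ξ, s.2.ren ρ ξ)

/-- `Lookup Γ i μ F A ν`: the variable `i` is bound as `x :_{μ_F} A` in `Γ`, and `ν` is the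
composition of the locks to the right of it. -/
inductive Lookup : Ctx → ℕ → Modality → Eff → Ty → Modality → Prop
  | here {Γ μ F A} : Lookup (.var μ F A :: Γ) 0 μ F A .one
  | skip {Γ i μ F A ν μ' F' A'} : Lookup Γ i μ F A ν →
      Lookup (.var μ' F' A' :: Γ) (i + 1) μ F A ν
  | lock {Γ i μ F A ν ξ G} : Lookup Γ i μ F A ν →
      Lookup (.lock ξ G :: Γ) i μ F A (ν.comp ξ)

/-- Global label contexts. -/
abbrev Sig := OpName → Option (Ty × Ty)

/-- The label `l` has type `A ↠ B` in the global or local label context. -/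
inductive HasLabel (S : Sig) (Λ : LCtx) : Label → Ty → Ty → Prop
  | glob {l A B} : S l = some (A, B) → HasLabel S Λ (.glob l) A B
  | loc {i A B} : Λ[i]? = some (A, B) → HasLabel S Λ (.loc i) A B

/-! ### The effect theory of sets -/

inductive AtomWf (S : Sig) (Δ : List Kind) (Λ : LCtx) : Atom → Prop
  | lab {l A B} : HasLabel S Λ l A B → AtomWf S Δ Λ (.lab l)
  | var {i} : Δ[i]? = some .effect → AtomWf S Δ Λ (.var i)

/-- Well-formed extensions and effect contexts. -/
def EffWf (S : Sig) (Δ : List Kind) (Λ : LCtx) (E : Eff) : Prop := ∀ x ∈ E, AtomWf S Δ Λ x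

/-- Equivalence of extensions and effect contexts. -/
inductive EffEquiv : Eff → Eff → Prop
  | refl {D} : EffEquiv D D
  | symm {D D'} : EffEquiv D D' → EffEquiv D' D
  | trans {D₁ D₂ D₃} : EffEquiv D₁ D₂ → EffEquiv D₂ D₃ → EffEquiv D₁ D₃
  | cons {x D D'} : EffEquiv D D' → EffEquiv (x :: D) (x :: D')
  | swap {x y D} : EffEquiv (x :: y :: D) (y :: x :: D)
  | contract {x D} : EffEquiv (x :: x :: D) (x :: D)

/-- Subeffecting `E ⩽ F`. -/
def SubEff (S : Sig) (Δ : List Kind) (Λ : LCtx) (E F : Eff) : Prop :=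
  ∃ E', EffWf S Δ Λ (E ++ E') ∧ EffEquiv (E ++ E') F

/-! ### Kinding and well-formedness -/

def ModWf (S : Sig) (Δ : List Kind) (Λ : LCtx) : Modality → Prop
  | .abs E => EffWf S Δ Λ E
  | .ext D => EffWf S Δ Λ D

/-- The kinding judgement for value types; only the kinds `abs` and `any` occur. -/
inductive Kinded (S : Sig) : List Kind → LCtx → Ty → Kind → Prop
  | sub {Δ Λ A} : Kinded S Δ Λ A .abs → Kinded S Δ Λ A .any
  | var {Δ Λ i K} : Δ[i]? = some K → K ≠ .effect → Kinded S Δ Λ (.var i) K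
  | unit {Δ Λ} : Kinded S Δ Λ .unit .abs
  | boxAbs {Δ Λ E A} : ModWf S Δ Λ (.abs E) → Kinded S Δ Λ A .any →
      Kinded S Δ Λ (.box (.abs E) A) .abs
  | boxExt {Δ Λ D A K} : ModWf S Δ Λ (.ext D) → Kinded S Δ Λ A K →
      Kinded S Δ Λ (.box (.ext D) A) K
  | arr {Δ Λ A B} : Kinded S Δ Λ A .any → Kinded S Δ Λ B .any → Kinded S Δ Λ (.arr A B) .any
  | all {Δ Λ K K' A} : Kinded S (K :: Δ) (LCtx.ren Nat.succ id Λ) A K' →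
      Kinded S Δ Λ (.all K A) K'

/-- Kinding of arguments of type applications. -/
inductive ArgKinded (S : Sig) (Δ : List Kind) (Λ : LCtx) : TArg → Kind → Prop
  | ty {A K} : Kinded S Δ Λ A K → ArgKinded S Δ Λ (.ty A) K
  | eff {E} : EffWf S Δ Λ E → ArgKinded S Δ Λ (.eff E) .effect

/-- Operation types `A ↠ B` are between types of kind `abs`. -/
def OpWf (S : Sig) (Δ : List Kind) (Λ : LCtx) (A B : Ty) : Prop :=
  Kinded S Δ Λ A .abs ∧ Kinded S Δ Λ B .abs

/-- Well-formed global label contexts. -/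
def Sig.Wf (S : Sig) : Prop := ∀ l A B, S l = some (A, B) → OpWf S [] [] A B

/-- Well-formedness `Γ @ E` of contexts at an effect context. -/
inductive CtxWf (S : Sig) (Δ : List Kind) (Λ : LCtx) : Ctx → Eff → Prop
  | nil {E} : (∀ s ∈ Λ, OpWf S Δ Λ s.1 s.2) → EffWf S Δ Λ E → CtxWf S Δ Λ [] E
  | var {Γ μ F A} : CtxWf S Δ Λ Γ F → ModWf S Δ Λ μ → Kinded S Δ Λ A .any →
      CtxWf S Δ Λ (.var μ F A :: Γ) F
  | lock {Γ μ F} : CtxWf S Δ Λ Γ F → ModWf S Δ Λ μ → CtxWf S Δ Λ (.lock μ F :: Γ) (μ.act F)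

/-! ### Type equivalence and modality transformations -/

inductive ModEquiv : Modality → Modality → Prop
  | abs {E F} : EffEquiv E F → ModEquiv (.abs E) (.abs F)
  | ext {D D'} : EffEquiv D D' → ModEquiv (.ext D) (.ext D')

inductive TyEquiv : List Kind → Ty → Ty → Prop
  | var {Δ i K} : Δ[i]? = some K → TyEquiv Δ (.var i) (.var i)
  | unit {Δ} : TyEquiv Δ .unit .unit
  | box {Δ μ ν A B} : ModEquiv μ ν → TyEquiv Δ A B → TyEquiv Δ (.box μ A) (.box ν B)
  | arr {Δ A A' B B'} : TyEquiv Δ A A' → TyEquiv Δ B B' → TyEquiv Δ (.arr A B) (.arr A' B')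
  | all {Δ K A B} : TyEquiv (K :: Δ) A B → TyEquiv Δ (.all K A) (.all K B)

/-- Modality transformations `μ ⇒ ν @ F`. -/
inductive ModTrans (S : Sig) (Δ : List Kind) (Λ : LCtx) : Modality → Modality → Eff → Prop
  | abs {E μ F} : SubEff S Δ Λ E (μ.act F) → ModTrans S Δ Λ (.abs E) μ F
  | extend {D₁ D₂ E} :
      (∀ F, SubEff S Δ Λ E F → SubEff S Δ Λ (D₁ ++ F) (D₂ ++ F)) →
      ModTrans S Δ Λ (.ext D₁) (.ext D₂) E

/-- Accessibility of variables, `(μ, A) ⇒ ν @ F`. -/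
inductive Access (S : Sig) (Δ : List Kind) (Λ : LCtx) : Modality → Ty → Modality → Eff → Prop
  | abs {μ A ν F} : Kinded S Δ Λ A .abs → Access S Δ Λ μ A ν F
  | trans {μ A ν F} : ModTrans S Δ Λ μ ν F → Access S Δ Λ μ A ν F

/-! ### Typing -/

/-- The typing judgement `Γ ⊢ M : A @ E`. An unannotated binding `x : A` is one with the identity
modality. -/
inductive HasType (S : Sig) : List Kind → LCtx → Ctx → Term → Ty → Eff → Prop
  | var {Δ Λ Γ i μ F A ν E} : CtxWf S Δ Λ Γ E → Lookup Γ i μ F A ν → Access S Δ Λ μ A ν F →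
      HasType S Δ Λ Γ (.var i) A E
  | mod {Δ Λ Γ μ V A F} : CtxWf S Δ Λ Γ F → V.IsValue →
      HasType S Δ Λ (.lock μ F :: Γ) V A (μ.act F) →
      HasType S Δ Λ Γ (.mod μ V) (.box μ A) F
  | letmod {Δ Λ Γ ν μ V M A B F} : CtxWf S Δ Λ Γ F → V.IsValue →
      HasType S Δ Λ (.lock ν F :: Γ) V (.box μ A) (ν.act F) →
      HasType S Δ Λ (.var (ν.comp μ) F A :: Γ) M B F →
      HasType S Δ Λ Γ (.letmod ν μ V M) B F
  | lam {Δ Λ Γ A B M E} : CtxWf S Δ Λ Γ E →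
      HasType S Δ Λ (.var .one E A :: Γ) M B E →
      HasType S Δ Λ Γ (.lam A M) (.arr A B) E
  | app {Δ Λ Γ A B M N E} : CtxWf S Δ Λ Γ E →
      HasType S Δ Λ Γ M (.arr A B) E → HasType S Δ Λ Γ N A E →
      HasType S Δ Λ Γ (.app M N) B E
  | tlam {Δ Λ Γ K V A E} : CtxWf S Δ Λ Γ E → V.IsValue →
      HasType S (K :: Δ) (LCtx.ren Nat.succ id Λ) (Ctx.ren Nat.succ id Γ) V A
        (Eff.ren Nat.succ id E) →
      HasType S Δ Λ Γ (.tlam K V) (.all K A) E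
  | tapp {Δ Λ Γ K M X A E} : CtxWf S Δ Λ Γ E →
      HasType S Δ Λ Γ M (.all K A) E → ArgKinded S Δ Λ X K →
      HasType S Δ Λ Γ (.tapp M X) (A.inst X) E
  | unit {Δ Λ Γ E} : CtxWf S Δ Λ Γ E → HasType S Δ Λ Γ .unit .unit E
  | perform {Δ Λ Γ l A B N E} : CtxWf S Δ Λ Γ (.lab l :: E) → HasLabel S Λ l A B →
      HasType S Δ Λ Γ N A (.lab l :: E) →
      HasType S Δ Λ Γ (.perform l N) B (.lab l :: E)
  | localLabel {Δ Λ Γ A B M A' E} : CtxWf S Δ Λ Γ E → OpWf S Δ Λ A B →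
      Kinded S Δ Λ A' .any →
      HasType S Δ (LCtx.ren id Nat.succ ((A, B) :: Λ)) (Ctx.ren id Nat.succ Γ) M
        (A'.ren id Nat.succ) (Eff.ren id Nat.succ E) →
      HasType S Δ Λ Γ (.localLabel A B M) A' E
  | handle {Δ Λ Γ μ l M N N' A B A' B' E F} : CtxWf S Δ Λ Γ F →
      μ.act F = E → ModTrans S Δ Λ μ .one F → ModTrans S Δ Λ μ (μ.comp μ) F →
      HasLabel S Λ l A' B' →
      HasType S Δ Λ (.lock (.ext [.lab l]) E :: .lock μ F :: Γ) M A (.lab l :: E) →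
      HasType S Δ Λ
        (.var .one E (.box (μ.comp (.ext [.lab l])) A) :: .lock μ F :: Γ) N B E →
      HasType S Δ Λ
        (.var .one E (.box μ (.arr B' B)) :: .var .one E A' :: .lock μ F :: Γ) N' B E →
      HasType S Δ Λ Γ (.handle μ l M N N') B F
  | conv {Δ Λ Γ M A B E} : HasType S Δ Λ Γ M A E → TyEquiv Δ A B → HasType S Δ Λ Γ M B E

end Met

/-! ## The translation -/

namespace FSn

def Kind.trans : Kind → Met.Kind
  | .value => .abs
  | .effect => .effect
  | .scope _ => .effect

/-- Translation of effect rows and scope variables to effect contexts (the cases for value types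
are never used on well-kinded rows). -/
def Ty.transEff : Ty → Met.Eff
  | .var i => [.var i]
  | .empty => []
  | .ext _ a E => a.transEff ++ E.transEff
  | .unit => []
  | .arr _ _ _ => []
  | .all _ _ => []
  | .ev _ _ => []

/-- Translation of value types, given the translated types `τ l` of operations `l` (the cases for
effect rows are never used on well-kinded types). -/
def Ty.transWith (τ : OpName → Met.Ty × Met.Ty) : Ty → Met.Ty
  | .var i => .var i
  | .unit => .unit
  | .arr A E B => .box (.abs E.transEff) (.arr (A.transWith τ) (B.transWith τ))
  | .all K A => .all K.trans (A.transWith τ)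
  | .ev l a => .box (.abs a.transEff) (.arr (τ l).1 (τ l).2)
  | .empty => .unit
  | .ext _ _ _ => .unit

/-- Translation of the operation types in the global label context, by recursion along
`Sig.Uses`. -/
noncomputable def Sig.transOp (S : Sig) (hS : S.Wf) : OpName → Met.Ty × Met.Ty :=
  hS.acyclic.fix fun l rec =>
    open Classical in
    let τ : OpName → Met.Ty × Met.Ty :=
      fun l' => if h : S.Uses l' l then rec l' h else (.unit, .unit)
    match S l with
    | some (A, B) => (A.transWith τ, B.transWith τ)
    | none => (.unit, .unit)

/-- Translation of value types. -/
noncomputable def Ty.trans (S : Sig) (hS : S.Wf) (A : Ty) : Met.Ty := A.transWith (S.transOp hS)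

/-- Translation of global label contexts. -/
noncomputable def Sig.trans (S : Sig) (hS : S.Wf) : Met.Sig :=
  fun l => (S l).map fun s => (s.1.trans S hS, s.2.trans S hS)

theorem Ty.transWith_congr {τ τ' : OpName → Met.Ty × Met.Ty} :
    ∀ A : Ty, (∀ l, A.MentionsEv l → τ l = τ' l) → A.transWith τ = A.transWith τ'
  | .var _, _ => rfl
  | .unit, _ => rfl
  | .arr A E B, h => by
      simp only [Ty.transWith]
      rw [Ty.transWith_congr A fun l hl => h l (Or.inl hl),
        Ty.transWith_congr B fun l hl => h l (Or.inr (Or.inr hl))]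
  | .all K A, h => by
      simp only [Ty.transWith]
      rw [Ty.transWith_congr A fun l hl => h l hl]
  | .ev l a, h => by
      simp only [Ty.transWith]
      rw [h l (Or.inl rfl)]
  | .empty, _ => rfl
  | .ext _ _ _, _ => rfl

theorem Sig.transOp_eq (S : Sig) (hS : S.Wf) {l : OpName} {A B : Ty} (h : S l = some (A, B)) :
    S.transOp hS l = (A.trans S hS, B.trans S hS) := by
  unfold Sig.transOp
  rw [WellFounded.fix_eq]
  simp only [h]
  refine Prod.ext ?_ ?_
  · refine Ty.transWith_congr A fun l' hl' => ?_
    rw [dif_pos ⟨A, B, h, Or.inl hl'⟩]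
    rfl
  · refine Ty.transWith_congr B fun l' hl' => ?_
    rw [dif_pos ⟨A, B, h, Or.inr hl'⟩]
    rfl

/-- The evidence type of `l : A ↠ B` at scope `a` becomes `[a](⟦A⟧ → ⟦B⟧)`. -/
theorem Ty.trans_ev (S : Sig) (hS : S.Wf) {l : OpName} {A B : Ty} (h : S l = some (A, B))
    (a : Ty) : (Ty.ev l a).trans S hS =
      .box (.abs a.transEff) (.arr (A.trans S hS) (B.trans S hS)) := by
  simp only [Ty.trans, Ty.transWith]
  rw [Sig.transOp_eq S hS h]
  rfl

/-- Translation of arguments of type applications, according to their kind. -/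
noncomputable def Ty.transArg (S : Sig) (hS : S.Wf) (A : Ty) : Kind → Met.TArg
  | .value => .ty (A.trans S hS)
  | .effect => .eff A.transEff
  | .scope _ => .eff A.transEff

/-- Translation of term variable contexts: `x : A` becomes `x :_{⟨⟩_F} ⟦A⟧`, where `F` is the
ambient effect context. -/
noncomputable def transCtx (S : Sig) (hS : S.Wf) (F : Met.Eff) (Γ : List Ty) : Met.Ctx :=
  Γ.map fun A => .var .one F (A.trans S hS)

/-- Weakening of a translated operation clause, with the variables `r` and `p`, by the function
argument `f` of the translated handler. -/
def skipFun : ℕ → ℕ := liftRen (liftRen Nat.succ)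

/-- The translation of `nhandler {l p r ↦ N}`:
```
mod_[E] (λ f^T. local l_a : A' ↠ B' in
  handle^[E] (let mod_[l_a, E] f' = f l_a in f' (mod_[l_a] (λ x^A'. do l_a x)))
  with {return x ↦ let mod_[l_a, E] x' = x in x', l_a p r ↦ N})
```
The local label `l_a` has index `0`; `T`, `A'`, `B'` and `E` are translations and hence
mention no local labels. -/
def handlerTerm (T A' B' : Met.Ty) (E : Met.Eff) (N : Met.Term) : Met.Term :=
  let la : Met.Label := .loc 0
  .mod (.abs E) (.lam T (.localLabel A' B' (.handle (.abs E) la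
    (.letmod .one (.abs (.lab la :: E)) (.tapp (.var 0) (.eff [.lab la]))
      (.app (.var 0) (.mod (.abs [.lab la]) (.lam A' (.perform la (.var 0))))))
    (.letmod .one (.abs (.lab la :: E)) (.var 0) (.var 0))
    (N.ren skipFun Nat.succ))))

mutual

/-- Translation of (derivations for) values. -/
noncomputable def ValTyping.trans {S : Sig} (hS : S.Wf) {Δ : List Kind} {Γ : List Ty} {V : Val}
    {A : Ty} : ValTyping S Δ Γ V A → Met.Term
  | .unit => .unit
  | .var (i := i) _ => .var i
  | .lam (E := E) (A := A) _ _ d =>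
      .mod (.abs E.transEff) (.lam (A.trans S hS) (d.trans hS))
  | .tlam (K := K) d => .tlam K.trans (d.trans hS)
  | .nhandler (l := l) (A' := A') (B' := B') (A := A) (E := E) _ _ _ d =>
      handlerTerm
        (Ty.trans S hS
          (.all (.scope l) (.arr (.ev l (.var 0)) (.ext l (.var 0) E.shift) A.shift)))
        (A'.trans S hS) (B'.trans S hS) E.transEff (d.trans hS)
  | .conv d _ => d.trans hS

/-- Translation of (derivations for) computations; `let x = M in N` of the target stands for
`(λ x. N) M`. -/
noncomputable def CompTyping.trans {S : Sig} (hS : S.Wf) {Δ : List Kind} {Γ : List Ty} {M : Comp}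
    {A E : Ty} : CompTyping S Δ Γ M A E → Met.Term
  | .ret d _ => d.trans hS
  | .app (E := E) d d' =>
      .letmod .one (.abs E.transEff) (d.trans hS)
        (.app (.var 0) ((d'.trans hS).ren Nat.succ id))
  | .tapp (K := K) (A := A) d _ _ => .tapp (d.trans hS) (A.transArg S hS K)
  | .letin (A := A) d d' => .app (.lam (A.trans S hS) (d'.trans hS)) (d.trans hS)
  | .perform (a := a) _ d d' _ =>
      .letmod .one (.abs a.transEff) (d.trans hS)
        (.app (.var 0) ((d'.trans hS).ren Nat.succ id))
  | .conv d _ _ => d.trans hS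

end

end FSn

theorem liftRen_id : liftRen id = id := by
  funext i; cases i <;> rfl

theorem liftRen_comp (ρ' ρ : ℕ → ℕ) : liftRen ρ' ∘ liftRen ρ = liftRen (ρ' ∘ ρ) := by
  funext i; cases i <;> rfl

namespace Met

/-! ## Renaming and substitution in the target calculus -/

theorem Label.ren_ren (ξ ξ' : ℕ → ℕ) (l : Label) : (l.ren ξ).ren ξ' = l.ren (ξ' ∘ ξ) := by
  cases l <;> rfl

theorem Label.ren_id (l : Label) : l.ren id = l := by
  cases l <;> rfl

theorem Atom.ren_ren (ρ ξ ρ' ξ' : ℕ → ℕ) (x : Atom) :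
    (x.ren ρ ξ).ren ρ' ξ' = x.ren (ρ' ∘ ρ) (ξ' ∘ ξ) := by
  cases x <;> simp [Atom.ren, Label.ren_ren]

theorem Atom.ren_id (x : Atom) : x.ren id id = x := by
  cases x <;> simp [Atom.ren, Label.ren_id]

theorem Eff.ren_ren (ρ ξ ρ' ξ' : ℕ → ℕ) (E : Eff) :
    Eff.ren ρ' ξ' (Eff.ren ρ ξ E) = Eff.ren (ρ' ∘ ρ) (ξ' ∘ ξ) E := by
  simp [Eff.ren, Atom.ren_ren, Function.comp_def]

theorem Eff.ren_id (E : Eff) : Eff.ren id id E = E := by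
  induction E with
  | nil => rfl
  | cons x E ih =>
    change x.ren id id :: Eff.ren id id E = _
    rw [ih, Atom.ren_id]

theorem Modality.ren_ren (ρ ξ ρ' ξ' : ℕ → ℕ) (μ : Modality) :
    (μ.ren ρ ξ).ren ρ' ξ' = μ.ren (ρ' ∘ ρ) (ξ' ∘ ξ) := by
  cases μ <;> simp [Modality.ren, Eff.ren_ren]

theorem Modality.ren_id (μ : Modality) : μ.ren id id = μ := by
  cases μ <;> simp [Modality.ren, Eff.ren_id]

theorem Ty.ren_ren (A : Ty) : ∀ ρ ξ ρ' ξ' : ℕ → ℕ,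
    (A.ren ρ ξ).ren ρ' ξ' = A.ren (ρ' ∘ ρ) (ξ' ∘ ξ) := by
  induction A <;> intro ρ ξ ρ' ξ' <;> simp_all [Ty.ren, Modality.ren_ren, liftRen_comp]

theorem Ty.ren_id (A : Ty) : A.ren id id = A := by
  induction A <;> simp_all [Ty.ren, Modality.ren_id, liftRen_id]

theorem TArg.ren_ren (ρ ξ ρ' ξ' : ℕ → ℕ) (X : TArg) :
    (X.ren ρ ξ).ren ρ' ξ' = X.ren (ρ' ∘ ρ) (ξ' ∘ ξ) := by
  cases X <;> simp [TArg.ren, Ty.ren_ren, Eff.ren_ren]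

theorem TArg.ren_id (X : TArg) : X.ren id id = X := by
  cases X <;> simp [TArg.ren, Ty.ren_id, Eff.ren_id]

theorem Term.ren_ren (M : Term) : ∀ ρ ξ ρ' ξ' : ℕ → ℕ,
    (M.ren ρ ξ).ren ρ' ξ' = M.ren (ρ' ∘ ρ) (ξ' ∘ ξ) := by
  induction M <;> intro ρ ξ ρ' ξ' <;>
    simp_all [Term.ren, Modality.ren_ren, liftRen_comp, Ty.ren_ren, TArg.ren_ren, Label.ren_ren]

theorem Term.ren_id (M : Term) : M.ren id id = M := by
  induction M <;>
    simp_all [Term.ren, Modality.ren_id, liftRen_id, Ty.ren_id, TArg.ren_id, Label.ren_id]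

theorem Term.IsValue.ren {M : Term} (h : M.IsValue) (ρ ξ : ℕ → ℕ) : (M.ren ρ ξ).IsValue := by
  induction M generalizing ρ ξ <;> simp_all [Term.ren, Term.IsValue]

theorem Modality.act_ren (ρ ξ : ℕ → ℕ) (μ : Modality) (F : Eff) :
    Eff.ren ρ ξ (μ.act F) = (μ.ren ρ ξ).act (Eff.ren ρ ξ F) := by
  cases μ <;> simp [Modality.act, Modality.ren, Eff.ren]

/-- Composition of a substitution with a renaming of type-level variables. -/
def Subst.compRen (σ : Subst) (ρ : ℕ → ℕ) : Subst := ⟨σ.ty ∘ ρ, σ.eff ∘ ρ⟩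

/-- The identity substitution. -/
def Subst.ident : Subst := ⟨.var, fun i => [.var i]⟩

theorem Subst.lift_compRen (σ : Subst) (ρ : ℕ → ℕ) :
    σ.lift.compRen (liftRen ρ) = (σ.compRen ρ).lift := by
  simp only [Subst.compRen, Subst.lift, Subst.mk.injEq]
  constructor <;> funext i <;> cases i <;> rfl

theorem Subst.lift_ident : Subst.ident.lift = Subst.ident := by
  simp only [Subst.ident, Subst.lift, Subst.mk.injEq]
  constructor <;> funext i <;> cases i <;> rfl

theorem Eff.subst_ren (σ : Subst) (ρ : ℕ → ℕ) (E : Eff) :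
    Eff.subst σ (Eff.ren ρ id E) = Eff.subst (σ.compRen ρ) E := by
  induction E with
  | nil => rfl
  | cons x E ih =>
    change (x.ren ρ id).subst σ ++ Eff.subst σ (Eff.ren ρ id E) = x.subst _ ++ Eff.subst _ E
    rw [ih]
    cases x with
    | lab l => cases l <;> rfl
    | var i => rfl

theorem Ty.subst_ren (A : Ty) : ∀ (σ : Subst) (ρ : ℕ → ℕ),
    (A.ren ρ id).subst σ = A.subst (σ.compRen ρ) := by
  induction A <;> intro σ ρ <;> simp_all [Ty.ren, Ty.subst, Subst.lift_compRen]
  case var => rfl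
  case box μ _ _ =>
    cases μ <;> simp [Modality.ren, Modality.subst, Eff.subst_ren]

theorem Eff.subst_ident (E : Eff) : Eff.subst .ident E = E := by
  induction E with
  | nil => rfl
  | cons x E ih =>
    change x.subst _ ++ Eff.subst _ E = _
    rw [ih]
    cases x <;> rfl

theorem Ty.subst_ident (A : Ty) : A.subst .ident = A := by
  induction A <;> simp_all [Ty.subst, Subst.lift_ident]
  case var => rfl
  case box μ _ _ =>
    cases μ <;> simp [Modality.subst, Eff.subst_ident]

theorem Ty.inst_shift (A : Ty) (X : TArg) : (A.ren Nat.succ id).inst X = A := by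
  rw [Ty.inst, Ty.subst_ren]
  exact Ty.subst_ident A

/-! ## Kinding in the target calculus -/

variable {S : Sig} {Δ Δ' : List Kind} {Λ Λ' : LCtx} {ρ ξ : ℕ → ℕ}

/-- `ρ` maps the variables of `Δ` to variables of the same kind in `Δ'`. -/
def KindRen (Δ Δ' : List Kind) (ρ : ℕ → ℕ) : Prop :=
  ∀ i K, Δ[i]? = some K → Δ'[ρ i]? = some K

/-- `ξ` maps the local labels of `Λ` to local labels of `Λ'`. -/
def LabelRen (Λ Λ' : LCtx) (ξ : ℕ → ℕ) : Prop :=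
  ∀ i, i < Λ.length → ξ i < Λ'.length

theorem KindRen.lift (h : KindRen Δ Δ' ρ) (K : Kind) :
    KindRen (K :: Δ) (K :: Δ') (liftRen ρ) := by
  intro i K' hi
  cases i with
  | zero => exact hi
  | succ i => exact h i K' hi

theorem KindRen.succ (Δ : List Kind) (K : Kind) : KindRen Δ (K :: Δ) Nat.succ :=
  fun _ _ h => h

theorem KindRen.ident (Δ : List Kind) : KindRen Δ Δ id := fun _ _ h => h

theorem LabelRen.ren {f g f' g' : ℕ → ℕ} (h : LabelRen Λ Λ' ξ) :
    LabelRen (LCtx.ren f g Λ) (LCtx.ren f' g' Λ') ξ := by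
  intro i hi
  simp only [LCtx.ren, List.length_map] at hi ⊢
  exact h i hi

theorem AtomWf.ren {x : Atom} (h : AtomWf S Δ Λ x) (hρ : KindRen Δ Δ' ρ)
    (hξ : LabelRen Λ Λ' ξ) : AtomWf S Δ' Λ' (x.ren ρ ξ) := by
  cases h with
  | var h => exact .var (hρ _ _ h)
  | lab h =>
    cases h with
    | glob h => exact .lab (.glob h)
    | loc h =>
      obtain ⟨hi, -⟩ := List.getElem?_eq_some_iff.1 h
      exact .lab (.loc (List.getElem?_eq_getElem (hξ _ hi)))

theorem EffWf.ren {E : Eff} (h : EffWf S Δ Λ E) (hρ : KindRen Δ Δ' ρ)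
    (hξ : LabelRen Λ Λ' ξ) : EffWf S Δ' Λ' (Eff.ren ρ ξ E) := by
  intro x hx
  obtain ⟨y, hy, rfl⟩ := List.mem_map.1 hx
  exact (h y hy).ren hρ hξ

theorem ModWf.ren {μ : Modality} (h : ModWf S Δ Λ μ) (hρ : KindRen Δ Δ' ρ)
    (hξ : LabelRen Λ Λ' ξ) : ModWf S Δ' Λ' (μ.ren ρ ξ) := by
  cases μ <;> exact EffWf.ren h hρ hξ

theorem Kinded.ren {A : Ty} {K : Kind} (h : Kinded S Δ Λ A K) :
    ∀ {Δ' : List Kind} {Λ' : LCtx} {ρ ξ : ℕ → ℕ}, KindRen Δ Δ' ρ → LabelRen Λ Λ' ξ →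
      Kinded S Δ' Λ' (A.ren ρ ξ) K := by
  induction h with
  | sub _ ih => exact fun hρ hξ => .sub (ih hρ hξ)
  | var h hK => exact fun hρ _ => .var (hρ _ _ h) hK
  | unit => exact fun _ _ => .unit
  | boxAbs h _ ih => exact fun hρ hξ => .boxAbs (ModWf.ren h hρ hξ) (ih hρ hξ)
  | boxExt h _ ih => exact fun hρ hξ => .boxExt (ModWf.ren h hρ hξ) (ih hρ hξ)
  | arr _ _ ih₁ ih₂ => exact fun hρ hξ => .arr (ih₁ hρ hξ) (ih₂ hρ hξ)
  | all _ ih => exact fun hρ hξ => .all (ih (hρ.lift _) hξ.ren)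

theorem Kinded.of_closed {A : Ty} {K : Kind} (h : Kinded S [] [] A K) (Δ : List Kind)
    (Λ : LCtx) : Kinded S Δ Λ A K := by
  rw [← A.ren_id]
  exact h.ren (fun i K h => by simp at h) (fun i h => by simp at h)

theorem AtomWf.ren_eq {x : Atom} (h : AtomWf S Δ Λ x) (hρ : ∀ i < Δ.length, ρ i = i)
    (hξ : ∀ i < Λ.length, ξ i = i) : x.ren ρ ξ = x := by
  cases h with
  | var h => simp [Atom.ren, hρ _ (List.getElem?_eq_some_iff.1 h).1]
  | lab h =>
    cases h with
    | glob h => rfl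
    | loc h => simp [Atom.ren, Label.ren, hξ _ (List.getElem?_eq_some_iff.1 h).1]

theorem ModWf.ren_eq {μ : Modality} (h : ModWf S Δ Λ μ) (hρ : ∀ i < Δ.length, ρ i = i)
    (hξ : ∀ i < Λ.length, ξ i = i) : μ.ren ρ ξ = μ := by
  have key : ∀ E : Eff, EffWf S Δ Λ E → Eff.ren ρ ξ E = E := fun E hE => by
    rw [Eff.ren, List.map_congr_left fun x hx => (hE x hx).ren_eq hρ hξ, List.map_id']
  cases μ <;> simp [Modality.ren, key _ h]

theorem Kinded.ren_eq {A : Ty} {K : Kind} (h : Kinded S Δ Λ A K) :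
    ∀ {ρ ξ : ℕ → ℕ}, (∀ i < Δ.length, ρ i = i) → (∀ i < Λ.length, ξ i = i) →
      A.ren ρ ξ = A := by
  induction h with
  | sub _ ih => exact ih
  | var h hK => exact fun hρ _ => by simp [Ty.ren, hρ _ (List.getElem?_eq_some_iff.1 h).1]
  | unit => exact fun _ _ => rfl
  | boxAbs h _ ih => exact fun hρ hξ => by rw [Ty.ren, h.ren_eq hρ hξ, ih hρ hξ]
  | boxExt h _ ih => exact fun hρ hξ => by rw [Ty.ren, h.ren_eq hρ hξ, ih hρ hξ]
  | arr _ _ ih₁ ih₂ => exact fun hρ hξ => by rw [Ty.ren, ih₁ hρ hξ, ih₂ hρ hξ]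
  | all _ ih =>
    intro ρ ξ hρ hξ
    rw [Ty.ren, ih _ fun i hi => hξ i (by simpa [LCtx.ren] using hi)]
    intro i hi
    cases i with
    | zero => rfl
    | succ i => simp [liftRen, hρ i (by simpa using hi)]

theorem ModWf.subst_eq {μ : Modality} {σ : Subst} (h : ModWf S Δ Λ μ)
    (hσ : ∀ i < Δ.length, σ.eff i = [.var i]) : μ.subst σ = μ := by
  have key : ∀ E : Eff, EffWf S Δ Λ E → Eff.subst σ E = E := by
    intro E hE
    induction E with
    | nil => rfl
    | cons x E ih =>
      change x.subst σ ++ Eff.subst σ E = _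
      rw [ih fun y hy => hE y (List.mem_cons_of_mem _ hy)]
      cases hE x List.mem_cons_self with
      | var h => simp [Atom.subst, hσ _ (List.getElem?_eq_some_iff.1 h).1]
      | lab h => rfl
  cases μ <;> simp [Modality.subst, key _ h]

theorem Kinded.subst_eq {A : Ty} {K : Kind} (h : Kinded S Δ Λ A K) :
    ∀ {σ : Subst}, (∀ i < Δ.length, σ.ty i = .var i) →
      (∀ i < Δ.length, σ.eff i = [.var i]) → A.subst σ = A := by
  induction h with
  | sub _ ih => exact ih
  | var h hK => exact fun hσ _ => by simp [Ty.subst, hσ _ (List.getElem?_eq_some_iff.1 h).1]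
  | unit => exact fun _ _ => rfl
  | boxAbs h _ ih => exact fun hσ hσ' => by rw [Ty.subst, h.subst_eq hσ', ih hσ hσ']
  | boxExt h _ ih => exact fun hσ hσ' => by rw [Ty.subst, h.subst_eq hσ', ih hσ hσ']
  | arr _ _ ih₁ ih₂ => exact fun hσ hσ' => by rw [Ty.subst, ih₁ hσ hσ', ih₂ hσ hσ']
  | all _ ih =>
    intro σ hσ hσ'
    rw [Ty.subst, ih]
    all_goals
      intro i hi
      cases i with
      | zero => rfl
      | succ i => simp [Subst.lift, hσ i (by simpa using hi), hσ' i (by simpa using hi), Ty.ren,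
          Eff.ren, Atom.ren]

/-! ## Contexts -/

theorem CtxWf.opWf {Γ : Ctx} {E : Eff} (h : CtxWf S Δ Λ Γ E) : ∀ s ∈ Λ, OpWf S Δ Λ s.1 s.2 := by
  induction h with
  | nil h _ => exact h
  | var _ _ _ ih => exact ih
  | lock _ _ ih => exact ih

theorem CtxWf.effWf {Γ : Ctx} {E : Eff} (h : CtxWf S Δ Λ Γ E) : EffWf S Δ Λ E := by
  induction h with
  | nil _ h => exact h
  | var _ _ _ ih => exact ih
  | @lock _ μ _ _ hμ ih =>
    cases μ with
    | abs E => exact hμ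
    | ext D => exact fun x hx => (List.mem_append.1 hx).elim (hμ x) (ih x)

theorem CtxWf.ren {Γ : Ctx} {E : Eff} (h : CtxWf S Δ Λ Γ E) (hρ : KindRen Δ Δ' ρ)
    (hξ : LabelRen Λ Λ' ξ) (hΛ' : ∀ s ∈ Λ', OpWf S Δ' Λ' s.1 s.2) :
    CtxWf S Δ' Λ' (Ctx.ren ρ ξ Γ) (Eff.ren ρ ξ E) := by
  induction h with
  | nil _ h => exact .nil hΛ' (h.ren hρ hξ)
  | var _ hμ hA ih => exact .var ih (hμ.ren hρ hξ) (hA.ren hρ hξ)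
  | lock _ hμ ih =>
    rw [Modality.act_ren]
    exact .lock ih (hμ.ren hρ hξ)

theorem CtxWf.shift {Γ : Ctx} {E : Eff} (h : CtxWf S Δ Λ Γ E) (K : Kind) :
    CtxWf S (K :: Δ) (LCtx.ren Nat.succ id Λ) (Ctx.ren Nat.succ id Γ)
      (Eff.ren Nat.succ id E) := by
  have hξ : LabelRen Λ (LCtx.ren Nat.succ id Λ) id := fun i hi => by simpa [LCtx.ren] using hi
  refine h.ren (KindRen.succ Δ K) hξ fun s hs => ?_
  obtain ⟨s', hs', rfl⟩ := List.mem_map.1 hs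
  have := h.opWf s' hs'
  exact ⟨this.1.ren (KindRen.succ Δ K) hξ, this.2.ren (KindRen.succ Δ K) hξ⟩

theorem CtxWf.localLabel {Γ : Ctx} {E : Eff} {A B : Ty} (h : CtxWf S Δ Λ Γ E)
    (hAB : OpWf S Δ Λ A B) :
    CtxWf S Δ (LCtx.ren id Nat.succ ((A, B) :: Λ)) (Ctx.ren id Nat.succ Γ)
      (Eff.ren id Nat.succ E) := by
  have hξ : LabelRen Λ (LCtx.ren id Nat.succ ((A, B) :: Λ)) Nat.succ :=
    fun i hi => by simpa [LCtx.ren] using hi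
  refine h.ren (KindRen.ident Δ) hξ fun s hs => ?_
  obtain ⟨s', hs', rfl⟩ := List.mem_map.1 hs
  have : OpWf S Δ Λ s'.1 s'.2 := by
    rcases List.mem_cons.1 hs' with rfl | hs'
    · exact hAB
    · exact h.opWf s' hs'
  exact ⟨this.1.ren (KindRen.ident Δ) hξ, this.2.ren (KindRen.ident Δ) hξ⟩

theorem Lookup.ren {Γ : Ctx} {i : ℕ} {μ ν : Modality} {F : Eff} {A : Ty}
    (h : Lookup Γ i μ F A ν) (ρ ξ : ℕ → ℕ) :
    ∃ ν', Lookup (Ctx.ren ρ ξ Γ) i (μ.ren ρ ξ) (Eff.ren ρ ξ F) (A.ren ρ ξ) ν' := by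
  induction h with
  | here => exact ⟨_, .here⟩
  | skip _ ih => exact ⟨_, .skip ih.choose_spec⟩
  | lock _ ih => exact ⟨_, .lock ih.choose_spec⟩

/-! ## Equivalence and transformations -/

theorem EffEquiv.of_perm {D D' : Eff} (h : D.Perm D') : EffEquiv D D' := by
  induction h with
  | nil => exact .refl
  | cons _ _ ih => exact .cons ih
  | swap => exact .swap
  | trans _ _ ih₁ ih₂ => exact .trans ih₁ ih₂

theorem EffEquiv.append_left (D : Eff) {E F : Eff} (h : EffEquiv E F) :
    EffEquiv (D ++ E) (D ++ F) := by
  induction D with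
  | nil => exact h
  | cons _ _ ih => exact .cons ih

theorem ModEquiv.refl (μ : Modality) : ModEquiv μ μ := by
  cases μ
  · exact .abs .refl
  · exact .ext .refl

theorem ModEquiv.symm {μ ν : Modality} (h : ModEquiv μ ν) : ModEquiv ν μ := by
  cases h with
  | abs h => exact .abs h.symm
  | ext h => exact .ext h.symm

theorem ModEquiv.trans {μ ν κ : Modality} (h : ModEquiv μ ν) (h' : ModEquiv ν κ) :
    ModEquiv μ κ := by
  cases h with
  | abs h => cases h' with | abs h' => exact .abs (h.trans h')
  | ext h => cases h' with | ext h' => exact .ext (h.trans h')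

theorem Kinded.tyEquiv_refl {A : Ty} {K : Kind} (h : Kinded S Δ Λ A K) : TyEquiv Δ A A := by
  induction h with
  | sub _ ih => exact ih
  | var h _ => exact .var h
  | unit => exact .unit
  | boxAbs _ _ ih => exact .box (.refl _) ih
  | boxExt _ _ ih => exact .box (.refl _) ih
  | arr _ _ ih₁ ih₂ => exact .arr ih₁ ih₂
  | all _ ih => exact .all ih

theorem TyEquiv.symm {A B : Ty} (h : TyEquiv Δ A B) : TyEquiv Δ B A := by
  induction h with
  | var h => exact .var h
  | unit => exact .unit
  | box h _ ih => exact .box h.symm ih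
  | arr _ _ ih₁ ih₂ => exact .arr ih₁ ih₂
  | all _ ih => exact .all ih

theorem TyEquiv.trans {A B C : Ty} (h : TyEquiv Δ A B) (h' : TyEquiv Δ B C) :
    TyEquiv Δ A C := by
  induction h generalizing C with
  | var h => exact h'
  | unit => exact h'
  | box h _ ih => cases h' with | box g g' => exact .box (h.trans g) (ih g')
  | arr _ _ ih₁ ih₂ => cases h' with | arr g g' => exact .arr (ih₁ g) (ih₂ g')
  | all _ ih => cases h' with | all g => exact .all (ih g)

theorem ModTrans.abs_one {D E F : Eff} (hDE : EffWf S Δ Λ (D ++ E))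
    (h : EffEquiv (D ++ E) F) : ModTrans S Δ Λ (.abs D) .one F :=
  .abs ⟨E, hDE, h⟩

end Met

namespace FSn

/-! ## Kinding in the source calculus -/

variable {S : Sig} {Δ : List Kind}

theorem Ty.ren_id (A : Ty) : A.ren id = A := by
  induction A <;> simp_all [Ty.ren, liftRen_id]

theorem Kinded.ren {A : Ty} {K : Kind} (h : Kinded S Δ A K) :
    ∀ {Δ' : List Kind} {ρ : ℕ → ℕ}, (∀ i K, Δ[i]? = some K → Δ'[ρ i]? = some K) →
      Kinded S Δ' (A.ren ρ) K := by
  induction h with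
  | var h => exact fun hρ => .var (hρ _ _ h)
  | unit => exact fun _ => .unit
  | arr _ _ _ ih₁ ih₂ ih₃ => exact fun hρ => .arr (ih₁ hρ) (ih₂ hρ) (ih₃ hρ)
  | all _ ih =>
    intro Δ' ρ hρ
    refine .all (ih fun i K hi => ?_)
    cases i with
    | zero => exact hi
    | succ i => exact hρ i K hi
  | ev hl _ ih => exact fun hρ => .ev hl (ih hρ)
  | empty => exact fun _ => .empty
  | ext hl _ _ ih₁ ih₂ => exact fun hρ => .ext hl (ih₁ hρ) (ih₂ hρ)

theorem Kinded.shift {A : Ty} {K : Kind} (h : Kinded S Δ A K) (K' : Kind) :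
    Kinded S (K' :: Δ) A.shift K :=
  h.ren fun _ _ hi => hi

theorem Kinded.of_closed {A : Ty} {K : Kind} (h : Kinded S [] A K) (Δ : List Kind) :
    Kinded S Δ A K := by
  rw [← A.ren_id]
  exact h.ren fun i K hi => by simp at hi

theorem Kinded.subst {A : Ty} {K : Kind} (h : Kinded S Δ A K) :
    ∀ {Δ' : List Kind} {σ : ℕ → Ty}, (∀ i K, Δ[i]? = some K → Kinded S Δ' (σ i) K) →
      Kinded S Δ' (A.subst σ) K := by
  induction h with
  | var h => exact fun hσ => hσ _ _ h
  | unit => exact fun _ => .unit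
  | arr _ _ _ ih₁ ih₂ ih₃ => exact fun hσ => .arr (ih₁ hσ) (ih₂ hσ) (ih₃ hσ)
  | all _ ih =>
    intro Δ' σ hσ
    refine .all (ih fun i K hi => ?_)
    cases i with
    | zero => exact .var hi
    | succ i => exact (hσ i K hi).shift _
  | ev hl _ ih => exact fun hσ => .ev hl (ih hσ)
  | empty => exact fun _ => .empty
  | ext hl _ _ ih₁ ih₂ => exact fun hσ => .ext hl (ih₁ hσ) (ih₂ hσ)

theorem Kinded.inst {A B : Ty} {K K' : Kind} (hB : Kinded S (K :: Δ) B K')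
    (hA : Kinded S Δ A K) : Kinded S Δ (B.inst A) K' := by
  refine hB.subst fun i K'' hi => ?_
  cases i with
  | zero =>
    obtain rfl : K = K'' := by simpa using hi
    exact hA
  | succ i => exact .var hi

theorem Equiv.kinded_iff {A A' : Ty} (h : Equiv A A') :
    ∀ {Δ : List Kind} {K : Kind}, Kinded S Δ A K ↔ Kinded S Δ A' K := by
  induction h with
  | refl => exact Iff.rfl
  | symm _ ih => exact ih.symm
  | trans _ _ ih₁ ih₂ => exact ih₁.trans ih₂
  | arr _ _ _ ih₁ ih₂ ih₃ =>
    refine ⟨?_, ?_⟩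
    · rintro (_ | _ | ⟨h₁, h₂, h₃⟩); exact .arr (ih₁.1 h₁) (ih₂.1 h₂) (ih₃.1 h₃)
    · rintro (_ | _ | ⟨h₁, h₂, h₃⟩); exact .arr (ih₁.2 h₁) (ih₂.2 h₂) (ih₃.2 h₃)
  | all _ ih =>
    refine ⟨fun h => ?_, fun h => ?_⟩
    · cases h with | all h => exact .all (ih.1 h)
    · cases h with | all h => exact .all (ih.2 h)
  | ext _ ih =>
    refine ⟨fun h => ?_, fun h => ?_⟩
    · cases h with | ext hl ha h => exact .ext hl ha (ih.1 h)
    · cases h with | ext hl ha h => exact .ext hl ha (ih.2 h)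
  | swap =>
    refine ⟨fun h => ?_, fun h => ?_⟩
    all_goals
      cases h with
      | ext hl ha h => cases h with | ext hl' ha' h => exact .ext hl' ha' (.ext hl ha h)

theorem CtxWf.cons {Γ : List Ty} {A : Ty} (hΓ : CtxWf S Δ Γ) (hA : Kinded S Δ A .value) :
    CtxWf S Δ (A :: Γ) := by
  intro B hB
  rcases List.mem_cons.1 hB with rfl | hB
  · exact hA
  · exact hΓ B hB

theorem CtxWf.shift {Γ : List Ty} (hΓ : CtxWf S Δ Γ) (K : Kind) :
    CtxWf S (K :: Δ) (Γ.map Ty.shift) := by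
  intro B hB
  obtain ⟨A, hA, rfl⟩ := List.mem_map.1 hB
  exact (hΓ A hA).shift K

theorem kinded_handlerTy {l : OpName} {A E : Ty} (hl : (S l).isSome)
    (hA : Kinded S Δ A .value) (hE : Kinded S Δ E .effect) :
    Kinded S Δ (handlerTy l E A) .value :=
  .arr (.all (.arr (.ev hl (.var rfl)) (.ext hl (.var rfl) (hE.shift _)) (hA.shift _))) hE hA

mutual

theorem ValTyping.kinded (hS : S.Wf) {Δ : List Kind} {Γ : List Ty} {V : Val} {A : Ty}
    (hΓ : CtxWf S Δ Γ) : ValTyping S Δ Γ V A → Kinded S Δ A .value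
  | .unit => .unit
  | .var h => hΓ _ (List.mem_of_getElem? h)
  | .lam hA hE d => .arr hA hE (d.kinded hS (hΓ.cons hA)).1
  | .tlam d => .all (d.kinded hS (hΓ.shift _))
  | .nhandler hl hA hE _ => kinded_handlerTy (by simp [hl]) hA hE
  | .conv d h => h.kinded_iff.1 (d.kinded hS hΓ)

theorem CompTyping.kinded (hS : S.Wf) {Δ : List Kind} {Γ : List Ty} {M : Comp} {A E : Ty}
    (hΓ : CtxWf S Δ Γ) : CompTyping S Δ Γ M A E → Kinded S Δ A .value ∧ Kinded S Δ E .effect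
  | .ret d hE => ⟨d.kinded hS hΓ, hE⟩
  | .app d _ => by
    cases d.kinded hS hΓ with
    | arr _ hE hB => exact ⟨hB, hE⟩
  | .tapp d hA hE => by
    cases d.kinded hS hΓ with
    | all hB => exact ⟨hB.inst hA, hE⟩
  | .letin d d' => d'.kinded hS (hΓ.cons (d.kinded hS hΓ).1)
  | .perform hl d _ hE => by
    refine ⟨(hS.kinded _ _ _ hl).2.of_closed _, ?_⟩
    cases d.kinded hS hΓ with
    | ev h ha => exact .ext h ha hE
  | .conv d h h' =>
    have := d.kinded hS hΓ
    ⟨h.kinded_iff.1 this.1, h'.kinded_iff.1 this.2⟩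

end

/-! ## The translation of types -/

theorem Ty.transEff_ren (A : Ty) (ρ ξ : ℕ → ℕ) :
    (A.ren ρ).transEff = Met.Eff.ren ρ ξ A.transEff := by
  induction A <;> simp_all [Ty.ren, Ty.transEff, Met.Eff.ren, Met.Atom.ren]

theorem Ty.transEff_eq_ren (A : Ty) (ξ : ℕ → ℕ) :
    Met.Eff.ren id ξ A.transEff = A.transEff := by
  rw [← Ty.transEff_ren, Ty.ren_id]

theorem Sig.transOp_none (hS : S.Wf) {l : OpName} (h : S l = none) :
    S.transOp hS l = (.unit, .unit) := by
  unfold Sig.transOp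
  rw [WellFounded.fix_eq]
  simp only [h]

theorem getElem?_map_trans {i : ℕ} {K : Kind} (h : Δ[i]? = some K) :
    (Δ.map Kind.trans)[i]? = some K.trans := by
  simp [h]

theorem Kind.trans_of_ne_value {K : Kind} (h : K ≠ .value) : K.trans = .effect := by
  cases K <;> first | rfl | exact absurd rfl h

theorem Kinded.effWf (hS : S.Wf) {A : Ty} {K : Kind} (h : Kinded S Δ A K) (hK : K ≠ .value)
    (Λ : Met.LCtx) : Met.EffWf (S.trans hS) (Δ.map Kind.trans) Λ A.transEff := by
  induction h with
  | @var Δ i K h =>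
    intro x hx
    obtain rfl := List.mem_singleton.1 hx
    refine .var ?_
    rw [getElem?_map_trans h, Kind.trans_of_ne_value hK]
  | ext _ _ _ ih₁ ih₂ =>
    exact fun x hx => (List.mem_append.1 hx).elim (ih₁ (by simp) x) (ih₂ (by simp) x)
  | empty => exact fun x hx => by simp [Ty.transEff] at hx
  | _ => exact absurd rfl hK

theorem Kinded.trans_of_mentionsEv (hS : S.Wf) {A : Ty} {K : Kind} (h : Kinded S Δ A K)
    (hK : K = .value)
    (hev : ∀ l, A.MentionsEv l → Met.OpWf (S.trans hS) [] [] (S.transOp hS l).1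
      (S.transOp hS l).2) :
    ∀ Λ, Met.Kinded (S.trans hS) (Δ.map Kind.trans) Λ (A.trans S hS) .abs := by
  induction h with
  | var h =>
    subst hK
    exact fun _ => .var (getElem?_map_trans h) (by simp)
  | unit => exact fun _ => .unit
  | arr _ hE _ ih₁ _ ih₃ =>
    exact fun Λ => .boxAbs (hE.effWf hS (by simp) Λ)
      (.arr (.sub (ih₁ rfl (fun l hl => hev l (.inl hl)) Λ))
        (.sub (ih₃ rfl (fun l hl => hev l (.inr (.inr hl))) Λ)))
  | all _ ih => exact fun Λ => .all (ih rfl hev _)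
  | ev _ ha _ =>
    obtain ⟨h₁, h₂⟩ := hev _ (.inl rfl)
    exact fun Λ => .boxAbs (ha.effWf hS (by simp) Λ)
      (.arr (.sub (h₁.of_closed _ Λ)) (.sub (h₂.of_closed _ Λ)))
  | empty => cases hK
  | ext => cases hK

theorem Sig.opWf_transOp (hS : S.Wf) (l : OpName) :
    Met.OpWf (S.trans hS) [] [] (S.transOp hS l).1 (S.transOp hS l).2 := by
  induction l using hS.acyclic.induction with
  | _ l ih =>
    rcases hl : S l with _ | ⟨A, B⟩
    · rw [Sig.transOp_none hS hl]
      exact ⟨.unit, .unit⟩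
    · rw [Sig.transOp_eq S hS hl]
      obtain ⟨hA, hB⟩ := hS.kinded l A B hl
      exact ⟨hA.trans_of_mentionsEv hS rfl (fun l' h => ih l' ⟨A, B, hl, .inl h⟩) [],
        hB.trans_of_mentionsEv hS rfl (fun l' h => ih l' ⟨A, B, hl, .inr h⟩) []⟩

theorem Sig.wf_trans (hS : S.Wf) : (S.trans hS).Wf := by
  intro l A B h
  obtain ⟨⟨A', B'⟩, hl, heq⟩ := Option.map_eq_some_iff.1 h
  obtain ⟨rfl, rfl⟩ := Prod.ext_iff.1 heq
  have := S.opWf_transOp hS l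
  rwa [Sig.transOp_eq S hS hl] at this

theorem Kinded.trans (hS : S.Wf) {A : Ty} (h : Kinded S Δ A .value) (Λ : Met.LCtx) :
    Met.Kinded (S.trans hS) (Δ.map Kind.trans) Λ (A.trans S hS) .abs :=
  h.trans_of_mentionsEv hS rfl (fun l _ => S.opWf_transOp hS l) Λ

theorem Kinded.argKinded (hS : S.Wf) {A : Ty} {K : Kind} (h : Kinded S Δ A K)
    (Λ : Met.LCtx) : Met.ArgKinded (S.trans hS) (Δ.map Kind.trans) Λ (A.transArg S hS K)
      K.trans := by
  cases K with
  | value => exact .ty (h.trans hS Λ)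
  | effect => exact .eff (h.effWf hS (by simp) Λ)
  | scope l => exact .eff (h.effWf hS (by simp) Λ)

theorem Ty.trans_ren (hS : S.Wf) (A : Ty) : ∀ ρ ξ : ℕ → ℕ,
    (A.ren ρ).trans S hS = (A.trans S hS).ren ρ ξ := by
  induction A with
  | ev l a =>
    intro ρ ξ
    obtain ⟨h₁, h₂⟩ := S.opWf_transOp hS l
    simp [Ty.ren, Ty.trans, Ty.transWith, Met.Ty.ren, Met.Modality.ren,
      Ty.transEff_ren _ ρ ξ, h₁.ren_eq, h₂.ren_eq]
  | arr A E B ih₁ _ ih₃ =>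
    intro ρ ξ
    simp only [Ty.trans] at ih₁ ih₃
    simp [Ty.ren, Ty.trans, Ty.transWith, Met.Ty.ren, Met.Modality.ren, Ty.transEff_ren E ρ ξ,
      ih₁ ρ ξ, ih₃ ρ ξ]
  | all K A ih =>
    intro ρ ξ
    simp only [Ty.trans] at ih
    simp [Ty.ren, Ty.trans, Ty.transWith, Met.Ty.ren, ih (liftRen ρ) ξ]
  | _ => intros; rfl

theorem Ty.trans_shift (hS : S.Wf) (A : Ty) (ξ : ℕ → ℕ) :
    A.shift.trans S hS = (A.trans S hS).ren Nat.succ ξ :=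
  A.trans_ren hS _ ξ

theorem Ty.trans_eq_ren (hS : S.Wf) (A : Ty) (ξ : ℕ → ℕ) :
    (A.trans S hS).ren id ξ = A.trans S hS := by
  rw [← Ty.trans_ren, Ty.ren_id]

/-- The substitution `σ'` translates `σ` on the variables of `Δ`. -/
structure TransSubst (hS : S.Wf) (Δ : List Kind) (σ : ℕ → Ty) (σ' : Met.Subst) : Prop where
  ty : ∀ i, Δ[i]? = some .value → σ'.ty i = (σ i).trans S hS
  eff : ∀ i K, Δ[i]? = some K → K ≠ .value → σ'.eff i = (σ i).transEff

theorem TransSubst.lift {hS : S.Wf} {σ : ℕ → Ty} {σ' : Met.Subst}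
    (h : TransSubst hS Δ σ σ') (K : Kind) :
    TransSubst hS (K :: Δ) (Ty.liftSubst σ) σ'.lift := by
  constructor
  · intro i hi
    cases i with
    | zero => rfl
    | succ i =>
      rw [Ty.liftSubst, Ty.trans_shift hS _ id, ← h.ty i hi]
      rfl
  · intro i K' hi hK
    cases i with
    | zero => rfl
    | succ i =>
      rw [Ty.liftSubst, Ty.shift, Ty.transEff_ren _ _ id, ← h.eff i K' hi hK]
      rfl

theorem Kinded.transEff_subst {hS : S.Wf} {A : Ty} {K : Kind} (h : Kinded S Δ A K)
    (hK : K ≠ .value) {σ : ℕ → Ty} {σ' : Met.Subst} (hσ : TransSubst hS Δ σ σ') :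
    (A.subst σ).transEff = Met.Eff.subst σ' A.transEff := by
  induction h with
  | var h => simp [Ty.subst, Ty.transEff, Met.Eff.subst, Met.Atom.subst, hσ.eff _ _ h hK]
  | ext _ _ _ ih₁ ih₂ =>
    simp only [Ty.subst, Ty.transEff, ih₁ (by simp) hσ, ih₂ (by simp) hσ, Met.Eff.subst,
      List.flatMap_append]
  | empty => rfl
  | _ => exact absurd rfl hK

theorem Kinded.trans_subst {hS : S.Wf} {A : Ty} {K : Kind} (h : Kinded S Δ A K)
    (hK : K = .value) : ∀ {σ : ℕ → Ty} {σ' : Met.Subst}, TransSubst hS Δ σ σ' →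
      (A.subst σ).trans S hS = (A.trans S hS).subst σ' := by
  induction h with
  | var h =>
    subst hK
    exact fun hσ => (hσ.ty _ h).symm
  | unit => exact fun _ => rfl
  | arr _ hE _ ih₁ _ ih₃ =>
    intro σ σ' hσ
    replace ih₁ := ih₁ rfl hσ
    replace ih₃ := ih₃ rfl hσ
    simp only [Ty.trans] at ih₁ ih₃
    simp only [Ty.subst, Ty.trans, Ty.transWith, Met.Ty.subst, Met.Modality.subst,
      hE.transEff_subst (by simp) hσ, ih₁, ih₃]
  | all _ ih =>
    intro σ σ' hσ
    replace ih := ih rfl (hσ.lift _)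
    simp only [Ty.trans] at ih
    simp only [Ty.subst, Ty.trans, Ty.transWith, Met.Ty.subst, ih]
  | @ev _ l _ _ ha _ =>
    intro σ σ' hσ
    obtain ⟨h₁, h₂⟩ := S.opWf_transOp hS l
    simp [Ty.subst, Ty.trans, Ty.transWith, Met.Ty.subst, Met.Modality.subst,
      ha.transEff_subst (by simp) hσ, h₁.subst_eq, h₂.subst_eq]
  | empty => cases hK
  | ext => cases hK

theorem Kinded.trans_inst (hS : S.Wf) {A B : Ty} {K : Kind}
    (hB : Kinded S (K :: Δ) B .value) :
    (B.inst A).trans S hS = (B.trans S hS).inst (A.transArg S hS K) := by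
  refine hB.trans_subst rfl ⟨fun i hi => ?_, fun i K' hi hK' => ?_⟩
  · cases i with
    | zero =>
      obtain rfl : K = .value := by simpa using hi
      rfl
    | succ i => rfl
  · cases i with
    | zero =>
      obtain rfl : K = K' := by simpa using hi
      cases K with
      | value => exact absurd rfl hK'
      | _ => rfl
    | succ i => rfl

theorem Equiv.transEff {A A' : Ty} (h : Equiv A A') :
    Met.EffEquiv A.transEff A'.transEff := by
  induction h with
  | symm _ ih => exact ih.symm
  | trans _ _ ih₁ ih₂ => exact ih₁.trans ih₂
  | ext _ ih => exact ih.append_left _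
  | swap =>
    refine .of_perm ?_
    simp only [Ty.transEff, ← List.append_assoc]
    exact List.perm_append_comm.append_right _
  | _ => exact .refl

theorem Equiv.trans_tyEquiv (hS : S.Wf) {A A' : Ty} (h : Equiv A A') :
    ∀ {Δ : List Kind}, Kinded S Δ A .value →
      Met.TyEquiv (Δ.map Kind.trans) (A.trans S hS) (A'.trans S hS) := by
  induction h with
  | refl => exact fun hA => (hA.trans hS []).tyEquiv_refl
  | symm h ih => exact fun hA => (ih (h.kinded_iff.2 hA)).symm
  | trans h _ ih₁ ih₂ => exact fun hA => (ih₁ hA).trans (ih₂ (h.kinded_iff.1 hA))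
  | arr _ hE _ ih₁ _ ih₃ =>
    intro Δ hA
    cases hA with
    | arr h₁ _ h₃ => exact .box (.abs hE.transEff) (.arr (ih₁ h₁) (ih₃ h₃))
  | all _ ih =>
    intro Δ hA
    cases hA with
    | all hA => exact .all (ih hA)
  | _ => exact fun hA => nomatch hA

end FSn

namespace Met

/-! ## Derived typing rules of the target calculus -/

variable {S : Sig} {Δ : List Kind} {Λ : LCtx} {Γ : Ctx}

theorem HasType.unbox_app {V W : Term} {A B : Ty} {D F : Eff} (hΓ : CtxWf S Δ Λ Γ F)
    (hD : EffWf S Δ Λ D) (hDF : ModTrans S Δ Λ (.abs D) .one F)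
    (hAB : Kinded S Δ Λ (.arr A B) .any) (hV : V.IsValue)
    (tV : HasType S Δ Λ (.lock .one F :: Γ) V (.box (.abs D) (.arr A B)) F)
    (tW : HasType S Δ Λ (.var (.abs D) F (.arr A B) :: Γ) W A F) :
    HasType S Δ Λ Γ (.letmod .one (.abs D) V (.app (.var 0) W)) B F := by
  have hΓ' : CtxWf S Δ Λ (.var (.abs D) F (.arr A B) :: Γ) F := .var hΓ hD hAB
  exact .letmod hΓ hV tV (.app hΓ' (.var hΓ' .here (.trans hDF)) tW)

/-- The translation `∀ a. [a, E]([a](A' → B') → A)` of the argument type of a named handler. -/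
def namedArgTy (A' B' A : Ty) (E : Eff) : Ty :=
  .all .effect (.box (.abs (.var 0 :: Eff.ren Nat.succ id E))
    (.arr (.box (.abs [.var 0]) (.arr (A'.ren Nat.succ id) (B'.ren Nat.succ id)))
      (A.ren Nat.succ id)))

theorem namedArgTy_inst (A' B' A : Ty) (E : Eff) (l : Label) :
    ∃ C, namedArgTy A' B' A E = .all .effect C ∧ C.inst (.eff [.lab l]) =
      .box (.abs (.lab l :: E)) (.arr (.box (.abs [.lab l]) (.arr A' B')) A) := by
  refine ⟨_, rfl, ?_⟩
  have h : ∀ C : Ty, (C.ren Nat.succ id).subst _ = C := fun C => C.inst_shift (.eff [.lab l])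
  simp only [Ty.inst, TArg.toTy, TArg.toEff] at h ⊢
  simp only [Ty.subst, Modality.subst, h]
  have hE : ∀ σ : Subst, Eff.subst σ (.var 0 :: Eff.ren Nat.succ id E) =
      σ.eff 0 ++ Eff.subst (σ.compRen Nat.succ) E := fun σ => by
    rw [← Eff.subst_ren]
    rfl
  rw [hE]
  simp only [List.singleton_append]
  congr 3
  exact E.subst_ident

theorem HasType.perform_fun {l : Label} {A' B' : Ty} {F : Eff} (hΓ : CtxWf S Δ Λ Γ F)
    (hl : HasLabel S Λ l A' B') (hA' : Kinded S Δ Λ A' .abs) :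
    HasType S Δ Λ Γ (.mod (.abs [.lab l]) (.lam A' (.perform l (.var 0))))
      (.box (.abs [.lab l]) (.arr A' B')) F := by
  have hD : EffWf S Δ Λ [.lab l] := fun x hx => by
    obtain rfl := List.mem_singleton.1 hx
    exact .lab hl
  have hΓ₁ : CtxWf S Δ Λ (.lock (.abs [.lab l]) F :: Γ) [.lab l] := .lock hΓ hD
  have hΓ₂ : CtxWf S Δ Λ (.var .one [.lab l] A' :: .lock (.abs [.lab l]) F :: Γ) [.lab l] :=
    .var hΓ₁ (fun _ h => nomatch h) (.sub hA')
  exact .mod hΓ trivial (.lam hΓ₁ (.perform hΓ₂ hl (.var hΓ₂ .here (.abs hA'))))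

theorem HasType.handle_named {l : Label} {A' B' A : Ty} {E : Eff} {N : Term}
    (hΓ : CtxWf S Δ Λ (.var .one E (namedArgTy A' B' A E) :: Γ) E)
    (hl : HasLabel S Λ l A' B') (hA' : Kinded S Δ Λ A' .abs) (hB' : Kinded S Δ Λ B' .abs)
    (hA : Kinded S Δ Λ A .abs) (hT : Kinded S Δ Λ (namedArgTy A' B' A E) .abs)
    (tN : HasType S Δ Λ
      (.var .one E (.box (.abs E) (.arr B' A)) :: .var .one E A' :: .lock (.abs E) E ::
        .var .one E (namedArgTy A' B' A E) :: Γ) N A E) :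
    HasType S Δ Λ (.var .one E (namedArgTy A' B' A E) :: Γ)
      (.handle (.abs E) l
        (.letmod .one (.abs (.lab l :: E)) (.tapp (.var 0) (.eff [.lab l]))
          (.app (.var 0) (.mod (.abs [.lab l]) (.lam A' (.perform l (.var 0))))))
        (.letmod .one (.abs (.lab l :: E)) (.var 0) (.var 0)) N) A E := by
  have hE : EffWf S Δ Λ E := hΓ.effWf
  have hlE : EffWf S Δ Λ (.lab l :: E) := fun x hx => by
    rcases List.mem_cons.1 hx with rfl | hx
    · exact .lab hl
    · exact hE x hx
  have hone : ModWf S Δ Λ .one := fun _ h => nomatch h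
  have hD : EffWf S Δ Λ [.lab l] := fun x hx => hlE x (by simp_all)
  have hEE : SubEff S Δ Λ E E := ⟨[], by simpa using hE, by simpa using .refl⟩
  have hlock : CtxWf S Δ Λ (.lock (.abs E) E :: .var .one E (namedArgTy A' B' A E) :: Γ) E :=
    .lock hΓ hE
  have hbody : CtxWf S Δ Λ (.lock (.ext [.lab l]) E :: .lock (.abs E) E ::
      .var .one E (namedArgTy A' B' A E) :: Γ) (.lab l :: E) := .lock hlock hD
  obtain ⟨C, hC, hinst⟩ := namedArgTy_inst A' B' A E l
  refine .handle hΓ rfl (.abs hEE) (.abs hEE) hl (A := A) ?_ ?_ tN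
  · have harr : Kinded S Δ Λ (.arr (.box (.abs [.lab l]) (.arr A' B')) A) .any :=
      .arr (.sub (.boxAbs hD (.arr (.sub hA') (.sub hB')))) (.sub hA)
    refine .unbox_app hbody hlE (.abs_one (E := []) (by simpa using hlE) (by simpa using .refl))
      harr trivial ?_ (.perform_fun (.var hbody hlE harr) hl hA')
    have hΓ' := CtxWf.lock hbody hone
    rw [← hinst]
    refine .tapp hΓ' ?_ (.eff hD)
    rw [← hC]
    exact .var hΓ' (.lock (.lock (.lock .here))) (.abs hT)
  · have hbox : Kinded S Δ Λ (.box (.abs (.lab l :: E)) A) .abs := .boxAbs hlE (.sub hA)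
    have hret : CtxWf S Δ Λ (.var .one E (.box (.abs (.lab l :: E)) A) :: .lock (.abs E) E ::
        .var .one E (namedArgTy A' B' A E) :: Γ) E := .var hlock hone (.sub hbox)
    exact .letmod hret trivial (.var (.lock hret hone) (.lock .here) (.abs hbox))
      (.var (.var hret hlE (.sub hA)) .here (.abs hA))

end Met

namespace FSn

variable {S : Sig} {hS : S.Wf} {Γ : List Ty} {Γ' : Met.Ctx} {ρ : ℕ → ℕ}

/-- The variables of `Γ` are, along `ρ`, variables of translated types in `Γ'`. -/
def Covers (hS : S.Wf) (Γ : List Ty) (Γ' : Met.Ctx) (ρ : ℕ → ℕ) : Prop :=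
  ∀ i A, Γ[i]? = some A → ∃ μ F ν, Met.Lookup Γ' (ρ i) μ F (A.trans S hS) ν

theorem Covers.lock (h : Covers hS Γ Γ' ρ) (μ : Met.Modality) (F : Met.Eff) :
    Covers hS Γ (.lock μ F :: Γ') ρ := by
  intro i A hi
  obtain ⟨_, _, _, h⟩ := h i A hi
  exact ⟨_, _, _, .lock h⟩

theorem Covers.skip (h : Covers hS Γ Γ' ρ) (μ : Met.Modality) (F : Met.Eff) (B : Met.Ty) :
    Covers hS Γ (.var μ F B :: Γ') (Nat.succ ∘ ρ) := by
  intro i A hi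
  obtain ⟨_, _, _, h⟩ := h i A hi
  exact ⟨_, _, _, .skip h⟩

theorem Covers.cons (h : Covers hS Γ Γ' ρ) (μ : Met.Modality) (F : Met.Eff) (A : Ty) :
    Covers hS (A :: Γ) (.var μ F (A.trans S hS) :: Γ') (liftRen ρ) := by
  intro i B hi
  cases i with
  | zero =>
    obtain rfl : A = B := by simpa using hi
    exact ⟨_, _, _, .here⟩
  | succ i => exact h.skip μ F _ i B hi

theorem Covers.shift (h : Covers hS Γ Γ' ρ) :
    Covers hS (Γ.map Ty.shift) (Met.Ctx.ren Nat.succ id Γ') ρ := by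
  intro i B hi
  rw [List.getElem?_map, Option.map_eq_some_iff] at hi
  obtain ⟨A, hA, rfl⟩ := hi
  obtain ⟨_, _, _, h⟩ := h i A hA
  rw [Ty.trans_shift hS A id]
  obtain ⟨_, h⟩ := h.ren Nat.succ id
  exact ⟨_, _, _, h⟩

theorem Covers.shiftLabel (h : Covers hS Γ Γ' ρ) :
    Covers hS Γ (Met.Ctx.ren id Nat.succ Γ') ρ := by
  intro i A hi
  obtain ⟨_, _, _, h⟩ := h i A hi
  rw [← Ty.trans_eq_ren hS A Nat.succ]
  obtain ⟨_, h⟩ := h.ren id Nat.succ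
  exact ⟨_, _, _, h⟩

theorem Ty.transArg_eq_ren (hS : S.Wf) (A : Ty) (K : Kind) (ξ : ℕ → ℕ) :
    (A.transArg S hS K).ren id ξ = A.transArg S hS K := by
  cases K <;> simp [Ty.transArg, Met.TArg.ren, Ty.trans_eq_ren, Ty.transEff_eq_ren]

theorem ValTyping.isValue_trans (hS : S.Wf) {Δ : List Kind} {Γ : List Ty} {V : Val} {A : Ty} :
    ∀ d : ValTyping S Δ Γ V A, (d.trans hS).IsValue
  | .unit => trivial
  | .var _ => trivial
  | .lam _ _ _ => by simp only [ValTyping.trans, Met.Term.IsValue]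
  | .tlam d => by
    simp only [ValTyping.trans, Met.Term.IsValue]
    exact d.isValue_trans hS
  | .nhandler _ _ _ _ => by simp only [ValTyping.trans, handlerTerm, Met.Term.IsValue]
  | .conv d _ => by
    simp only [ValTyping.trans]
    exact d.isValue_trans hS

theorem trans_namedArg (hS : S.Wf) {l : OpName} {A' B' : Ty} (hl : S l = some (A', B'))
    (A E : Ty) :
    Ty.trans S hS (.all (.scope l) (.arr (.ev l (.var 0)) (.ext l (.var 0) E.shift) A.shift)) =
      Met.namedArgTy (A'.trans S hS) (B'.trans S hS) (A.trans S hS) E.transEff := by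
  have h := Sig.transOp_eq S hS hl
  obtain ⟨h₁, h₂⟩ := S.opWf_transOp hS l
  have e₁ := h₁.ren_eq (ρ := Nat.succ) (ξ := id) (by simp) (by simp)
  have e₂ := h₂.ren_eq (ρ := Nat.succ) (ξ := id) (by simp) (by simp)
  have hA := Ty.trans_shift hS A id
  rw [h] at e₁ e₂
  rw [Met.namedArgTy, e₁, e₂, ← hA, ← Ty.transEff_ren]
  simp only [Ty.trans, Ty.transWith, Ty.transEff, h]
  rfl

theorem trans_handlerTy (hS : S.Wf) {l : OpName} {A' B' : Ty} (hl : S l = some (A', B'))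
    (A E : Ty) :
    (handlerTy l E A).trans S hS = .box (.abs E.transEff)
      (.arr (Met.namedArgTy (A'.trans S hS) (B'.trans S hS) (A.trans S hS) E.transEff)
        (A.trans S hS)) := by
  rw [← trans_namedArg hS hl]
  rfl

theorem ren_handlerTerm {T A' B' : Met.Ty} {E : Met.Eff} (N : Met.Term) (ρ ξ : ℕ → ℕ)
    (hT : ∀ ξ, T.ren id ξ = T) (hA' : ∀ ξ, A'.ren id ξ = A') (hB' : ∀ ξ, B'.ren id ξ = B')
    (hE : ∀ ξ, Met.Eff.ren id ξ E = E) :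
    (handlerTerm T A' B' E N).ren ρ ξ =
      .mod (.abs E) (.lam T (.localLabel A' B' (.handle (.abs E) (.loc 0)
        (.letmod .one (.abs (.lab (.loc 0) :: E)) (.tapp (.var 0) (.eff [.lab (.loc 0)]))
          (.app (.var 0) (.mod (.abs [.lab (.loc 0)])
            (.lam A' (.perform (.loc 0) (.var 0))))))
        (.letmod .one (.abs (.lab (.loc 0) :: E)) (.var 0) (.var 0))
        (N.ren (liftRen (liftRen (Nat.succ ∘ ρ))) (Nat.succ ∘ ξ))))) := by
  have hE' : ∀ ξ, List.map (Met.Atom.ren id ξ) E = E := hE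
  simp only [handlerTerm, Met.Term.ren, Met.Modality.ren, Met.Modality.one, Met.Label.ren,
    Met.TArg.ren, Met.Eff.ren, List.map_cons, List.map_nil, Met.Atom.ren, liftRen, hT, hA', hB',
    hE', Met.Term.ren_ren, skipFun, liftRen_comp]
  rfl

/-! ## Type preservation -/

mutual

theorem ValTyping.hasType_trans (hS : S.Wf) {Δ : List Kind} {Γ : List Ty} {V : Val} {A : Ty}
    (hΓ : CtxWf S Δ Γ) : ∀ (d : ValTyping S Δ Γ V A) {Λ : Met.LCtx} {Γ' : Met.Ctx} {F : Met.Eff}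
      {ρ : ℕ → ℕ} (ξ : ℕ → ℕ), Met.CtxWf (S.trans hS) (Δ.map Kind.trans) Λ Γ' F →
      Covers hS Γ Γ' ρ →
      Met.HasType (S.trans hS) (Δ.map Kind.trans) Λ Γ' ((d.trans hS).ren ρ ξ) (A.trans S hS) F
  | .unit, _, _, _, _, _, hΓ', _ => by
    simp only [ValTyping.trans]
    exact .unit hΓ'
  | .var (i := i) (A := A) h, Λ, _, _, _, _, hΓ', hc => by
    obtain ⟨μ, F, ν, hi⟩ := hc _ _ h
    simp only [ValTyping.trans]
    exact .var hΓ' hi (.abs ((hΓ _ (List.mem_of_getElem? h)).trans hS Λ))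
  | .lam (E := E) (A := A) (B := B) hA hE d, Λ, _, _, _, ξ, hΓ', hc => by
    simp only [ValTyping.trans, Met.Term.ren, Met.Modality.ren, Ty.trans_eq_ren,
      Ty.transEff_eq_ren]
    have hΓ₁ := Met.CtxWf.lock hΓ' (μ := .abs E.transEff) (hE.effWf hS (by simp) Λ)
    refine .mod hΓ' trivial (.lam hΓ₁ (d.hasType_trans hS (hΓ.cons hA) ξ .refl ?_
      ((hc.lock _ _).cons _ _ A)))
    exact .var hΓ₁ (fun _ h => nomatch h) (.sub (hA.trans hS Λ))
  | .tlam (K := K) d, _, _, _, _, ξ, hΓ', hc => by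
    simp only [ValTyping.trans, Met.Term.ren]
    exact .tlam hΓ' ((d.isValue_trans hS).ren _ _)
      (d.hasType_trans hS (hΓ.shift K) ξ (hΓ'.shift K.trans) hc.shift)
  | .nhandler (l := l) (A' := A') (B' := B') (A := A) (E := E) hl hA hE d,
      Λ, Γ', F, ρ, ξ, hΓ', hc => by
    have hT := kinded_handlerTy (l := l) (by simp [hl]) hA hE
    cases hT with
    | arr hT _ _ =>
    obtain ⟨hA', hB'⟩ := hS.kinded _ _ _ hl
    replace hA' := hA'.of_closed Δ
    replace hB' := hB'.of_closed Δ
    have hone : ∀ {Λ}, Met.ModWf (S.trans hS) (Δ.map Kind.trans) Λ .one :=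
      fun _ h => nomatch h
    have hTt := fun Λ => hT.trans hS Λ
    simp only [ValTyping.trans]
    rw [ren_handlerTerm _ _ _ (Ty.trans_eq_ren hS _) (Ty.trans_eq_ren hS _)
      (Ty.trans_eq_ren hS _) E.transEff_eq_ren]
    have hT_ren := Ty.trans_eq_ren hS
      (.all (.scope l) (.arr (.ev l (.var 0)) (.ext l (.var 0) E.shift) A.shift)) Nat.succ
    rw [trans_namedArg hS hl] at hTt hT_ren ⊢
    rw [trans_handlerTy hS hl]
    have hΓ₁ := Met.CtxWf.lock hΓ' (μ := .abs E.transEff) (hE.effWf hS (by simp) Λ)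
    have hΓ₂ := Met.CtxWf.var hΓ₁ hone (.sub (hTt Λ))
    have hop : Met.OpWf (S.trans hS) (Δ.map Kind.trans) Λ (A'.trans S hS) (B'.trans S hS) :=
      ⟨hA'.trans hS Λ, hB'.trans hS Λ⟩
    refine .mod hΓ' trivial (.lam hΓ₁ (.localLabel hΓ₂ hop (.sub (hA.trans hS Λ)) ?_))
    have hΓ₃ := hΓ₂.localLabel hop
    have hc₃ := ((hc.lock (.abs E.transEff) F).skip .one E.transEff
      (Met.namedArgTy (A'.trans S hS) (B'.trans S hS) (A.trans S hS) E.transEff)).shiftLabel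
    have hren : Met.Ctx.ren id Nat.succ (.var .one E.transEff
        (Met.namedArgTy (A'.trans S hS) (B'.trans S hS) (A.trans S hS) E.transEff) ::
          .lock (.abs E.transEff) F :: Γ') = .var .one E.transEff
        (Met.namedArgTy (A'.trans S hS) (B'.trans S hS) (A.trans S hS) E.transEff) ::
          Met.Ctx.ren id Nat.succ (.lock (.abs E.transEff) F :: Γ') := by
      change Met.Entry.var .one (Met.Eff.ren id Nat.succ _) (Met.Ty.ren _ id Nat.succ) :: _ = _
      rw [hT_ren, Ty.transEff_eq_ren]
      rfl
    simp only [Met.Modality.act, Ty.trans_eq_ren, Ty.transEff_eq_ren] at hΓ₃ ⊢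
    rw [hren] at hΓ₃ hc₃ ⊢
    have hla : Met.HasLabel (S.trans hS)
        (Met.LCtx.ren id Nat.succ ((A'.trans S hS, B'.trans S hS) :: Λ)) (.loc 0)
        (A'.trans S hS) (B'.trans S hS) :=
      .loc (by simp [Met.LCtx.ren, Ty.trans_eq_ren])
    have hΓ₄ := Met.CtxWf.lock hΓ₃ (μ := .abs E.transEff) (hE.effWf hS (by simp) _)
    have hr := Kinded.arr hB' hE hA
    refine .handle_named hΓ₃ hla (hA'.trans hS _) (hB'.trans hS _) (hA.trans hS _) (hTt _) ?_
    exact d.hasType_trans hS ((hΓ.cons hA').cons hr) (Nat.succ ∘ ξ) .refl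
      (.var (.var hΓ₄ hone (.sub (hA'.trans hS _))) hone (.sub (hr.trans hS _)))
      (((hc₃.lock (.abs E.transEff) E.transEff).cons .one E.transEff A').cons .one E.transEff
        (.arr B' E A))
  | .conv d h, _, _, _, _, ξ, hΓ', hc => by
    simp only [ValTyping.trans]
    exact .conv (d.hasType_trans hS hΓ ξ hΓ' hc) (h.trans_tyEquiv hS (d.kinded hS hΓ))

theorem CompTyping.hasType_trans (hS : S.Wf) {Δ : List Kind} {Γ : List Ty} {M : Comp}
    {A E : Ty} (hΓ : CtxWf S Δ Γ) : ∀ (d : CompTyping S Δ Γ M A E) {Λ : Met.LCtx} {Γ' : Met.Ctx}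
      {F : Met.Eff} {ρ : ℕ → ℕ} (ξ : ℕ → ℕ), Met.EffEquiv E.transEff F →
      Met.CtxWf (S.trans hS) (Δ.map Kind.trans) Λ Γ' F → Covers hS Γ Γ' ρ →
      Met.HasType (S.trans hS) (Δ.map Kind.trans) Λ Γ' ((d.trans hS).ren ρ ξ) (A.trans S hS) F
  | .ret d _, _, _, _, _, ξ, _, hΓ', hc => by
    simp only [CompTyping.trans]
    exact d.hasType_trans hS hΓ ξ hΓ' hc
  | .app (A := A) (B := B) (E := E) d d', Λ, Γ', F, ρ, ξ, hEF, hΓ', hc => by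
    cases d.kinded hS hΓ with
    | arr hA hE hB =>
    have hEt := hE.effWf hS (by simp) Λ
    have hAB := Met.Kinded.arr (.sub (hA.trans hS Λ)) (.sub (hB.trans hS Λ))
    simp only [CompTyping.trans, Met.Term.ren, Met.Modality.ren, Ty.transEff_eq_ren,
      Met.Term.ren_ren]
    refine .unbox_app hΓ' hEt (.abs_one (E := []) (by simpa using hEt) (by simpa using hEF)) hAB
      ((d.isValue_trans hS).ren _ _)
      (d.hasType_trans hS hΓ ξ (.lock hΓ' fun _ h => nomatch h) (hc.lock _ _))
      (d'.hasType_trans hS hΓ _ (.var hΓ' hEt hAB) (hc.skip _ _ _))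
  | .tapp (K := K) d hA hE, Λ, _, _, _, ξ, _, hΓ', hc => by
    cases d.kinded hS hΓ with
    | all hB =>
    simp only [CompTyping.trans, Met.Term.ren, Ty.transArg_eq_ren]
    rw [hB.trans_inst hS]
    exact .tapp hΓ' (d.hasType_trans hS hΓ ξ hΓ' hc) (hA.argKinded hS Λ)
  | .letin (A := A) d d', Λ, _, _, _, ξ, hEF, hΓ', hc => by
    have hA := (d.kinded hS hΓ).1
    simp only [CompTyping.trans, Met.Term.ren, Ty.trans_eq_ren]
    refine .app hΓ' (.lam hΓ' (d'.hasType_trans hS (hΓ.cons hA) ξ hEF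
      (.var hΓ' (fun _ h => nomatch h) (.sub (hA.trans hS Λ))) (hc.cons _ _ A)))
      (d.hasType_trans hS hΓ ξ hEF hΓ' hc)
  | .perform (l := l) (a := a) (A := A) (B := B) (E := E) hl d d' hE,
      Λ, Γ', F, ρ, ξ, hEF, hΓ', hc => by
    cases d.kinded hS hΓ with
    | ev _ ha =>
    obtain ⟨hA, hB⟩ := hS.kinded _ _ _ hl
    have hat := ha.effWf hS (by simp) Λ
    have hEt := hE.effWf hS (by simp) Λ
    have hAB := Met.Kinded.arr (.sub ((hA.of_closed Δ).trans hS Λ))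
      (.sub ((hB.of_closed Δ).trans hS Λ))
    simp only [CompTyping.trans, Met.Term.ren, Met.Modality.ren, Ty.transEff_eq_ren,
      Met.Term.ren_ren]
    have tV := d.hasType_trans hS hΓ ξ (Met.CtxWf.lock hΓ' (μ := .one) fun _ h => nomatch h)
      (hc.lock _ _)
    rw [Ty.trans_ev S hS hl] at tV
    exact .unbox_app hΓ' hat
      (.abs_one (fun x hx => (List.mem_append.1 hx).elim (hat x) (hEt x)) hEF) hAB
      ((d.isValue_trans hS).ren _ _) tV
      (d'.hasType_trans hS hΓ _ (.var hΓ' hat hAB) (hc.skip _ _ _))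
  | .conv d h h', _, _, _, _, ξ, hEF, hΓ', hc => by
    simp only [CompTyping.trans]
    exact .conv (d.hasType_trans hS hΓ ξ (h'.transEff.trans hEF) hΓ' hc)
      (h.trans_tyEquiv hS (d.kinded hS hΓ).1)

end

theorem covers_transCtx (hS : S.Wf) (F : Met.Eff) (Γ : List Ty) :
    Covers hS Γ (transCtx S hS F Γ) id := by
  induction Γ with
  | nil => exact fun i A hi => by simp at hi
  | cons A Γ ih =>
    rw [← liftRen_id]
    exact ih.cons .one F A

theorem CtxWf.trans (hS : S.Wf) {Δ : List Kind} {F : Met.Eff} (hΓ : CtxWf S Δ Γ)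
    (hF : Met.EffWf (S.trans hS) (Δ.map Kind.trans) [] F) :
    Met.CtxWf (S.trans hS) (Δ.map Kind.trans) [] (transCtx S hS F Γ) F := by
  induction Γ with
  | nil => exact .nil (fun s hs => nomatch hs) hF
  | cons A Γ ih =>
    exact .var (ih fun B hB => hΓ B (List.mem_cons_of_mem _ hB)) (fun _ h => nomatch h)
      (.sub ((hΓ A List.mem_cons_self).trans hS []))

end FSn

theorem mainTheorem9 (S : FSn.Sig) (hS : S.Wf) (Δ : List FSn.Kind) (Γ : List FSn.Ty)
    (hΓ : FSn.CtxWf S Δ Γ) :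
    (S.trans hS).Wf ∧
    (∀ (M : FSn.Comp) (A E : FSn.Ty) (d : FSn.CompTyping S Δ Γ M A E),
      Met.HasType (S.trans hS) (Δ.map FSn.Kind.trans) [] (FSn.transCtx S hS E.transEff Γ)
        (d.trans hS) (A.trans S hS) E.transEff) ∧
    (∀ (V : FSn.Val) (A : FSn.Ty) (d : FSn.ValTyping S Δ Γ V A) (F : Met.Eff),
      Met.EffWf (S.trans hS) (Δ.map FSn.Kind.trans) [] F →
      Met.HasType (S.trans hS) (Δ.map FSn.Kind.trans) [] (FSn.transCtx S hS F Γ)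
        (d.trans hS) (A.trans S hS) F) := by
  refine ⟨FSn.Sig.wf_trans hS, fun M A E d => ?_, fun V A d F hF => ?_⟩
  · have hE := (d.kinded hS hΓ).2.effWf hS (by simp) []
    have := d.hasType_trans hS hΓ id .refl (hΓ.trans hS hE) (FSn.covers_transCtx hS _ Γ)
    rwa [Met.Term.ren_id] at this
  · have := d.hasType_trans hS hΓ id (hΓ.trans hS hF) (FSn.covers_transCtx hS F Γ)
    rwa [Met.Term.ren_id] at this
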